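/- Let $Q$ be a smooth $n$-dimensional manifold with a smooth pseudo-Riemannian metric $g$; write $G=g^{-1}$, let $\Gamma^i_{jk}$ be the Christoffel symbols of the Levi-Civita connection $\nabla$ of $g$, and let $\nabla V=G\,dV$ denote the gradient of a function $V$. A smooth $(1,1)$-tensor field $\mathbf J=(J^i_j)$ is called a $J$-tensor of $g$ if $J^i_kG^{kj}$ is symmetric and $\nabla_hJ^i_j=\alpha_j\delta^i_h+\alpha^i g_{jh}$ for some $1$-form $\alpha$ (with $\alpha^i=G^{ik}\alpha_k$). Let $\operatorname{cof}\mathbf J$ be the transposed matrix of signed minors of $\mathbf J$, so that $\mathbf J\operatorname{cof}\mathbf J=(\det\mathbf J)I$. Let $\mathbf J_1,\mathbf J_2$ be $J$-tensors of $g$ that are nonsingular at every point, put $\sigma_i=\det\mathbf J_i$, let $V,W$ be smooth functions on $Q$, and suppose that the vector fields $(\operatorname{cof}\mathbf J_1)^{-1}\nabla V$ and $(\operatorname{cof}\mathbf J_2)^{-1}\nabla W$ coincide. Consider the bi-cofactor system $$\frac{d^2q^i}{dt^2}+\Gamma^i_{jk}\frac{dq^j}{dt}\frac{dq^k}{dt}=-\left((\operatorname{cof}\mathbf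 J_1)^{-1}\nabla V\right)^i=-\left((\operatorname{cof}\mathbf J_2)^{-1}\nabla W\right)^i,\qquad i=1,\dots,n.$$ In the coordinates $(q^i,p_j)$ that a chart of $Q$ induces on $T^*Q$, put $$\Pi_{nc}(\mathbf J)=\begin{pmatrix}0&\mathbf J\\-\mathbf J^T&\Omega\end{pmatrix},\qquad \Omega^i_j=\left(\frac{\partial J^k_i}{\partial q^j}-\frac{\partial J^k_j}{\partial q^i}\right)p_k ,$$ $$H=\tfrac12p^T(\operatorname{cof}\mathbf J_1)Gp+V(q),\qquad F=\tfrac12p^T(\operatorname{cof}\mathbf J_2)Gp+W(q).$$ Then in every chart of $Q$ the following holds. 1. With the momenta $p_i=g_{ij}\,dq^j/dt$, the bi-cofactor system is equivalent to each of the two first-order systems $$\frac{d}{dt}\begin{pmatrix}q\\p\end{pmatrix}=\frac1{\sigma_1}\Pi_{nc}(\mathbf J_1)\,dH=\frac1{\sigma_2}\Pi_{nc}(\mathbf J_2)\,dF ;$$ that is, on any open set of times, a curve $(q(t),p(t))$ solves the first (equivalently, the second) of these systems if and only if $q(t)$ solves the bi-cofactor system and $p_i=g_{ij}\,dq^j/dt$.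 Moreover the two vector fields on the right coincide. 2. $\Pi_{nc}(\mathbf J_1)$ and $\Pi_{nc}(\mathbf J_2)$ are compatible Poisson operators: for all real constants $\eta_1,\eta_2$ the operator $\eta_1\Pi_{nc}(\mathbf J_1)+\eta_2\Pi_{nc}(\mathbf J_2)$ is Poisson, i.e. smooth, skew-symmetric and with a bracket satisfying the Jacobi identity. -/

import Mathlib

open scoped Manifold ContDiff Matrix

noncomputable section

namespace BiCofactor

/-! ### Coordinate calculus on open subsets of `ℝⁿ` and `ℝ²ⁿ` -/

/-- The partial derivative `∂f/∂xᵃ` of a real function of finitely many real variables. -/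
def pd {ι : Type*} [Fintype ι] [DecidableEq ι] (a : ι) (f : (ι → ℝ) → ℝ) (x : ι → ℝ) : ℝ :=
  fderiv ℝ f x (Pi.single a 1)

/-- The differential `df = (∂f/∂xᵃ)ₐ`. -/
def differential {ι : Type*} [Fintype ι] [DecidableEq ι] (f : (ι → ℝ) → ℝ) (x : ι → ℝ) : ι → ℝ :=
  fun a => pd a f x

/-- The Christoffel symbols `Γⁱⱼₖ = ½ Gⁱˡ (∂ⱼ gₖₗ + ∂ₖ gⱼₗ - ∂ₗ gⱼₖ)` of the Levi-Civita connection
of the covariant metric `g`, with `G = g⁻¹`. -/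
def christoffel {n : ℕ} (g : (Fin n → ℝ) → Matrix (Fin n) (Fin n) ℝ) (q : Fin n → ℝ)
    (i j k : Fin n) : ℝ :=
  (1 / 2) * ∑ l, (g q)⁻¹ i l *
    (pd j (fun x => g x k l) q + pd k (fun x => g x j l) q - pd l (fun x => g x j k) q)

/-- The covariant derivative `∇ₕ Jⁱⱼ = ∂ₕ Jⁱⱼ + Γⁱₕₗ Jˡⱼ - Γˡₕⱼ Jⁱₗ` of a `(1,1)`-tensor. -/
def covDeriv {n : ℕ} (g J : (Fin n → ℝ) → Matrix (Fin n) (Fin n) ℝ) (q : Fin n → ℝ)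
    (h i j : Fin n) : ℝ :=
  pd h (fun x => J x i j) q + ∑ l, christoffel g q i h l * J q l j
    - ∑ l, christoffel g q l h j * J q i l

/-- The curve `q` solves `q̈ⁱ + Γⁱⱼₖ q̇ʲ q̇ᵏ = Fⁱ(q)` at all times in `s`. -/
def IsNewtonSolutionOn {n : ℕ} (g : (Fin n → ℝ) → Matrix (Fin n) (Fin n) ℝ)
    (F : (Fin n → ℝ) → Fin n → ℝ) (q : ℝ → Fin n → ℝ) (s : Set ℝ) : Prop :=
  ∀ t ∈ s, DifferentiableAt ℝ q t ∧ DifferentiableAt ℝ (deriv q) t ∧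
    ∀ i, deriv (deriv q) t i
      + ∑ j, ∑ k, christoffel g (q t) i j k * deriv q t j * deriv q t k = F (q t) i

/-- A matrix-valued function `P` on the coordinate domain `D` is a Poisson operator: it is smooth,
skew-symmetric, and its Schouten bracket with itself vanishes, i.e. the bracket
`{f, h} = (∂f/∂xᵃ) Pᵃᵇ (∂h/∂xᵇ)` satisfies the Jacobi identity. -/
structure IsPoissonOn {ι : Type*} [Fintype ι] [DecidableEq ι] (D : Set (ι → ℝ))
    (P : (ι → ℝ) → Matrix ι ι ℝ) : Prop where
  smooth : ∀ a b, ContDiffOn ℝ ∞ (fun z => P z a b) D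
  skew : ∀ z ∈ D, (P z)ᵀ = -P z
  jacobi : ∀ z ∈ D, ∀ a b c,
    ∑ d, (P z a d * pd d (fun y => P y b c) z + P z b d * pd d (fun y => P y c a) z
      + P z c d * pd d (fun y => P y a b) z) = 0

/-- Two operators are compatible Poisson operators if all their linear combinations with constant
coefficients (in particular each of them) are Poisson operators. -/
def AreCompatiblePoissonOn {ι : Type*} [Fintype ι] [DecidableEq ι] (D : Set (ι → ℝ))
    (P₁ P₂ : (ι → ℝ) → Matrix ι ι ℝ) : Prop :=
  ∀ η₁ η₂ : ℝ, IsPoissonOn D (fun z => η₁ • P₁ z + η₂ • P₂ z)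

/-- A point of the phase space in coordinates is `z = (q, p)`; this is its position part. -/
def pos {n : ℕ} (z : Fin n ⊕ Fin n → ℝ) : Fin n → ℝ := fun i => z (Sum.inl i)

/-- The momentum part `p` of `z = (q, p)`. -/
def mom {n : ℕ} (z : Fin n ⊕ Fin n → ℝ) : Fin n → ℝ := fun i => z (Sum.inr i)

/-- The block `Ω`, with entry `(∂Jᵏᵢ/∂qʲ - ∂Jᵏⱼ/∂qⁱ) pₖ` in row `i` and column `j`. -/
def Omega {n : ℕ} (J : (Fin n → ℝ) → Matrix (Fin n) (Fin n) ℝ) (z : Fin n ⊕ Fin n → ℝ) :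
    Matrix (Fin n) (Fin n) ℝ :=
  Matrix.of fun i j =>
    ∑ k, (pd j (fun x => J x k i) (pos z) - pd i (fun x => J x k j) (pos z)) * mom z k

/-- The operator `Π_nc(J)`, with blocks `0`, `J`, `-Jᵀ`, `Ω`. -/
def PiNC {n : ℕ} (J : (Fin n → ℝ) → Matrix (Fin n) (Fin n) ℝ) (z : Fin n ⊕ Fin n → ℝ) :
    Matrix (Fin n ⊕ Fin n) (Fin n ⊕ Fin n) ℝ :=
  Matrix.fromBlocks 0 (J (pos z)) (-(J (pos z))ᵀ) (Omega J z)

/-- The cofactor Hamiltonian `½ pᵀ (cof J) G p + V(q)`, with `G = g⁻¹`; here `cof J` is the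
transposed matrix of signed minors, which is Mathlib's `adjugate`. -/
def cofactorHamiltonian {n : ℕ} (g J : (Fin n → ℝ) → Matrix (Fin n) (Fin n) ℝ)
    (V : (Fin n → ℝ) → ℝ) (z : Fin n ⊕ Fin n → ℝ) : ℝ :=
  (1 / 2) * (mom z ⬝ᵥ (((J (pos z)).adjugate * (g (pos z))⁻¹) *ᵥ mom z)) + V (pos z)

/-- The vector field `(1/σ) Π_nc(J) dH` on the phase space, with `σ = det J`. -/
def quasiHamiltonianField {n : ℕ} (J : (Fin n → ℝ) → Matrix (Fin n) (Fin n) ℝ)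
    (H : (Fin n ⊕ Fin n → ℝ) → ℝ) (z : Fin n ⊕ Fin n → ℝ) : Fin n ⊕ Fin n → ℝ :=
  (1 / (J (pos z)).det) • (PiNC J z *ᵥ differential H z)

/-! ### Tensor fields on a manifold and their components in charts -/

section Manifold

variable {n : ℕ} {Q : Type*} [TopologicalSpace Q] [ChartedSpace (Fin n → ℝ) Q]

/-- A field of bilinear forms on the tangent spaces. -/
abbrev BilinField (n : ℕ) (Q : Type*) [TopologicalSpace Q] [ChartedSpace (Fin n → ℝ) Q] :=
  ∀ x : Q, TangentSpace 𝓘(ℝ, Fin n → ℝ) x →L[ℝ] TangentSpace 𝓘(ℝ, Fin n → ℝ) x →L[ℝ] ℝ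

/-- A `(1,1)`-tensor field. -/
abbrev EndoField (n : ℕ) (Q : Type*) [TopologicalSpace Q] [ChartedSpace (Fin n → ℝ) Q] :=
  ∀ x : Q, TangentSpace 𝓘(ℝ, Fin n → ℝ) x →L[ℝ] TangentSpace 𝓘(ℝ, Fin n → ℝ) x

/-- A field of covectors. -/
abbrev CovectorField (n : ℕ) (Q : Type*) [TopologicalSpace Q] [ChartedSpace (Fin n → ℝ) Q] :=
  ∀ x : Q, TangentSpace 𝓘(ℝ, Fin n → ℝ) x →L[ℝ] ℝ

/-- A vector field. -/
abbrev VecField (n : ℕ) (Q : Type*) [TopologicalSpace Q] [ChartedSpace (Fin n → ℝ) Q] :=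
  ∀ x : Q, TangentSpace 𝓘(ℝ, Fin n → ℝ) x

/-- The coordinate charts of `Q`: the charts of its maximal smooth atlas. -/
abbrev charts (n : ℕ) (Q : Type*) [TopologicalSpace Q] [ChartedSpace (Fin n → ℝ) Q] :
    Set (OpenPartialHomeomorph Q (Fin n → ℝ)) :=
  IsManifold.maximalAtlas 𝓘(ℝ, Fin n → ℝ) ∞ Q

/-- The coordinate vector `∂/∂qⁱ` of the chart `e`, at the point with coordinates `u`. -/
def frame (e : OpenPartialHomeomorph Q (Fin n → ℝ)) (u : Fin n → ℝ) (i : Fin n) :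
    TangentSpace 𝓘(ℝ, Fin n → ℝ) (e.symm u) :=
  mfderiv 𝓘(ℝ, Fin n → ℝ) 𝓘(ℝ, Fin n → ℝ) e.symm u
    ((Pi.single i 1 : Fin n → ℝ) : TangentSpace 𝓘(ℝ, Fin n → ℝ) u)

/-- The components `(dqⁱ(v))ᵢ` in the chart `e` of a tangent vector at the point with
coordinates `u`. -/
def tangentCoord (e : OpenPartialHomeomorph Q (Fin n → ℝ)) (u : Fin n → ℝ)
    (v : TangentSpace 𝓘(ℝ, Fin n → ℝ) (e.symm u)) : Fin n → ℝ :=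
  mfderiv 𝓘(ℝ, Fin n → ℝ) 𝓘(ℝ, Fin n → ℝ) e (e.symm u) v

/-- The components `gᵢⱼ`. -/
def bilinCoord (g : BilinField n Q) (e : OpenPartialHomeomorph Q (Fin n → ℝ)) (u : Fin n → ℝ) :
    Matrix (Fin n) (Fin n) ℝ :=
  Matrix.of fun i j => g (e.symm u) (frame e u i) (frame e u j)

/-- The components `Jⁱⱼ` (row `i`, column `j`). -/
def endoCoord (J : EndoField n Q) (e : OpenPartialHomeomorph Q (Fin n → ℝ)) (u : Fin n → ℝ) :
    Matrix (Fin n) (Fin n) ℝ :=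
  Matrix.of fun i j => tangentCoord e u (J (e.symm u) (frame e u j)) i

/-- The components `αᵢ`. -/
def covectorCoord (α : CovectorField n Q) (e : OpenPartialHomeomorph Q (Fin n → ℝ))
    (u : Fin n → ℝ) : Fin n → ℝ :=
  fun i => α (e.symm u) (frame e u i)

/-- The components `Fⁱ`. -/
def vecCoord (F : VecField n Q) (e : OpenPartialHomeomorph Q (Fin n → ℝ))
    (u : Fin n → ℝ) : Fin n → ℝ :=
  tangentCoord e u (F (e.symm u))

/-- A function on `Q` in coordinates. -/
def funCoord (V : Q → ℝ) (e : OpenPartialHomeomorph Q (Fin n → ℝ)) (u : Fin n → ℝ) : ℝ :=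
  V (e.symm u)

/-- `g` is a (smooth) pseudo-Riemannian metric. -/
structure IsPseudoMetric (g : BilinField n Q) : Prop where
  smooth : ∀ e ∈ charts n Q, ∀ i j, ContDiffOn ℝ ∞ (fun u => bilinCoord g e u i j) e.target
  symm : ∀ x v w, g x v w = g x w v
  nondegenerate : ∀ x v, (∀ w, g x v w = 0) → v = 0

/-- `J` is a (smooth) `J`-tensor of the metric `g`: `Jⁱₖ Gᵏʲ` is symmetric and
`∇ₕ Jⁱⱼ = αⱼ δⁱₕ + αⁱ gⱼₕ` for some `1`-form `α`, where `αⁱ = Gⁱᵏ αₖ`. -/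
structure IsJTensor (g : BilinField n Q) (J : EndoField n Q) : Prop where
  smooth : ∀ e ∈ charts n Q, ∀ i j, ContDiffOn ℝ ∞ (fun u => endoCoord J e u i j) e.target
  symm : ∀ e ∈ charts n Q, ∀ u ∈ e.target, (endoCoord J e u * (bilinCoord g e u)⁻¹).IsSymm
  characteristic : ∃ α : CovectorField n Q, ∀ e ∈ charts n Q, ∀ u ∈ e.target, ∀ h i j,
    covDeriv (bilinCoord g e) (endoCoord J e) u h i j
      = covectorCoord α e u j * (if i = h then 1 else 0)
        + ((bilinCoord g e u)⁻¹ *ᵥ covectorCoord α e u) i * bilinCoord g e u j h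

/-- `F = -(cof J)⁻¹ ∇V`, where `∇V = G dV`. -/
def IsCofactorForce (g : BilinField n Q) (J : EndoField n Q) (V : Q → ℝ) (F : VecField n Q) :
    Prop :=
  ∀ e ∈ charts n Q, ∀ u ∈ e.target,
    vecCoord F e u = -((endoCoord J e u).adjugate⁻¹ *ᵥ
      ((bilinCoord g e u)⁻¹ *ᵥ differential (funCoord V e) u))

end Manifold

end BiCofactor

end

/-!
The argument takes place in a chart with domain `D`, where the metric is a matrix-valued function
`g` with inverse `G`, `Γ_h` is the matrix with entries `Γⁱₕₗ`, and the equation of a `J`-tensor is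
`∂ₕ J = J Γ_h - Γ_h J + e_h αᵀ + (G α) (g e_h)ᵀ` (`IsJTensorOn.matDeriv_eq`). Besides this, only the
two properties of the Levi-Civita connection are used: it is torsion-free and
`∂ₕ g = g Γ_h + Γ_hᵀ g`.

*Poisson property.* The components of the Schouten bracket of `Π_nc(J)` are the components of the
Nijenhuis torsion `N` of `J` (one position and two momenta), the contractions
`(∂ₐ Nᵐ_{bc} + ∂_b Nᵐ_{ca} + ∂_c Nᵐ_{ab}) pₘ` up to sign (three momenta), and zero otherwise, so
`Π_nc(J)` is Poisson when `N = 0` (`isPoissonOn_PiNC`). The torsion of a `J`-tensor vanishes: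
partial derivatives may be replaced by covariant ones, and the terms in `α` cancel because `J` is
self-adjoint (`IsJTensorOn.torsion_eq_zero`). Compatibility is then automatic, since the `J`-tensors
of a fixed metric form a vector space and `Π_nc` is linear in `J`.

*The vector fields.* The field `(1/σ) Π_nc(J) dH` is shown to be
`q̇ = G p`, `ṗᵢ = Γᵏᵢₗ (G p)ˡ pₖ + gᵢₗ Fˡ` with `F = -(cof J)⁻¹ ∇V`
(`quasiHamiltonianField_eq_newtonField`), an expression in which `J` and `V` enter only through `F`;
hence the two fields of the theorem coincide. With `w = J⁻¹ G p`, the momentum equation follows from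
Jacobi's formula `∂ₗ σ = 2 σ (J⁻ᵀ α)ₗ`, which gives the derivative
`2 σ ((J⁻ᵀ α)ₗ (p·w) - p·Γ_l w - (α·w) (g w)ₗ)` of `pᵀ (cof J) G p`, and from the value of `Ω w`
(`IsJTensorOn.Omega_mulVec`): all the terms with `α` cancel.

*Curves.* The derivative of `g q̇` along a curve is `g ∇_q̇ q̇` plus the connection term of the
field above (`IsMetricOn.hasDerivAt_momentum`), and this makes the first-order system equivalent to
Newton's equations (`isNewtonSolutionOn_iff`).
-/

noncomputable section

namespace BiCofactor

/-! ### Calculus of partial derivatives -/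

lemma differentiableAt_of_contDiffOn {ι : Type*} [Fintype ι] {D : Set (ι → ℝ)} (hD : IsOpen D)
    {f : (ι → ℝ) → ℝ} (hf : ContDiffOn ℝ ∞ f D) {x : ι → ℝ} (hx : x ∈ D) :
    DifferentiableAt ℝ f x :=
  (hf.contDiffAt (hD.mem_nhds hx)).differentiableAt (by simp)

section Calculus

variable {ι : Type*} [Fintype ι] [DecidableEq ι]

lemma pd_congr {a : ι} {f h : (ι → ℝ) → ℝ} {x : ι → ℝ} (hfh : f =ᶠ[nhds x] h) :
    pd a f x = pd a h x := by
  rw [pd, pd, hfh.fderiv_eq]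

lemma pd_const (a : ι) (c : ℝ) (x : ι → ℝ) : pd a (fun _ => c) x = 0 := by
  simp [pd]

lemma pd_add {a : ι} {f h : (ι → ℝ) → ℝ} {x : ι → ℝ} (hf : DifferentiableAt ℝ f x)
    (hh : DifferentiableAt ℝ h x) : pd a (fun y => f y + h y) x = pd a f x + pd a h x := by
  simp [pd, fderiv_fun_add hf hh]

lemma pd_sub {a : ι} {f h : (ι → ℝ) → ℝ} {x : ι → ℝ} (hf : DifferentiableAt ℝ f x)
    (hh : DifferentiableAt ℝ h x) : pd a (fun y => f y - h y) x = pd a f x - pd a h x := by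
  simp [pd, fderiv_fun_sub hf hh]

lemma pd_neg (a : ι) (f : (ι → ℝ) → ℝ) (x : ι → ℝ) : pd a (fun y => -f y) x = -pd a f x := by
  simp [pd, fderiv_fun_neg]

lemma pd_const_mul {a : ι} {f : (ι → ℝ) → ℝ} {x : ι → ℝ} (hf : DifferentiableAt ℝ f x) (c : ℝ) :
    pd a (fun y => c * f y) x = c * pd a f x := by
  simp [pd, fderiv_const_mul hf]

lemma pd_linearCombination {a : ι} {f h : (ι → ℝ) → ℝ} {x : ι → ℝ} (hf : DifferentiableAt ℝ f x)
    (hh : DifferentiableAt ℝ h x) (c d : ℝ) :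
    pd a (fun y => c * f y + d * h y) x = c * pd a f x + d * pd a h x := by
  rw [pd_add (hf.const_mul c) (hh.const_mul d), pd_const_mul hf, pd_const_mul hh]

lemma pd_mul {a : ι} {f h : (ι → ℝ) → ℝ} {x : ι → ℝ} (hf : DifferentiableAt ℝ f x)
    (hh : DifferentiableAt ℝ h x) :
    pd a (fun y => f y * h y) x = pd a f x * h x + f x * pd a h x := by
  simp [pd, fderiv_fun_mul hf hh]
  ring

lemma pd_sum {κ : Type*} {s : Finset κ} {a : ι} {f : κ → (ι → ℝ) → ℝ} {x : ι → ℝ}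
    (hf : ∀ k ∈ s, DifferentiableAt ℝ (f k) x) :
    pd a (fun y => ∑ k ∈ s, f k y) x = ∑ k ∈ s, pd a (f k) x := by
  simp [pd, fderiv_fun_sum hf]

/-- Partial derivatives commute. -/
lemma pd_comm {a b : ι} {f : (ι → ℝ) → ℝ} {x : ι → ℝ} (hf : ContDiffAt ℝ ∞ f x) :
    pd a (pd b f) x = pd b (pd a f) x := by
  have hd : DifferentiableAt ℝ (fderiv ℝ f) x :=
    (hf.fderiv_right (m := 1) (by norm_cast)).differentiableAt (by simp)
  have key : ∀ c d : ι, pd c (pd d f) x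
      = fderiv ℝ (fderiv ℝ f) x (Pi.single c 1) (Pi.single d 1) := fun c d => by
    change fderiv ℝ (fun y => fderiv ℝ f y (Pi.single d 1)) x (Pi.single c 1) = _
    rw [fderiv_clm_apply hd (by fun_prop)]
    simp
  rw [key, key]
  exact (hf.isSymmSndFDerivAt (by simp; norm_cast)).eq _ _

lemma contDiffOn_pd {D : Set (ι → ℝ)} (hD : IsOpen D) {f : (ι → ℝ) → ℝ}
    (hf : ContDiffOn ℝ ∞ f D) (a : ι) : ContDiffOn ℝ ∞ (pd a f) D :=
  (hf.fderiv_of_isOpen hD (m := ∞) (by simp)).clm_apply contDiffOn_const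

lemma fderiv_apply_eq_sum_pd (f : (ι → ℝ) → ℝ) (x v : ι → ℝ) :
    fderiv ℝ f x v = ∑ a, v a * pd a f x := by
  conv_lhs => rw [pi_eq_sum_univ' v, map_sum]
  simp only [map_smul, smul_eq_mul, pd]

lemma hasDerivAt_comp_curve {f : (ι → ℝ) → ℝ} {q : ℝ → ι → ℝ} {q' : ι → ℝ} {t : ℝ}
    (hf : DifferentiableAt ℝ f (q t)) (hq : HasDerivAt q q' t) :
    HasDerivAt (fun τ => f (q τ)) (∑ a, q' a * pd a f (q t)) t := by
  rw [← fderiv_apply_eq_sum_pd]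
  exact hf.hasFDerivAt.comp_hasDerivAt t hq

end Calculus

/-! ### Partial derivatives of matrix-valued functions -/

section MatrixCalculus

variable {ι : Type*} [Fintype ι] [DecidableEq ι] {κ : Type*}

/-- The entrywise partial derivative of a matrix-valued function. -/
def matDeriv (a : ι) (M : (ι → ℝ) → Matrix κ κ ℝ) (x : ι → ℝ) : Matrix κ κ ℝ :=
  Matrix.of fun i j => pd a (fun y => M y i j) x

@[simp] lemma matDeriv_apply (a : ι) (M : (ι → ℝ) → Matrix κ κ ℝ) (x : ι → ℝ) (i j : κ) :
    matDeriv a M x i j = pd a (fun y => M y i j) x := rfl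

lemma matDeriv_congr {a : ι} {M N : (ι → ℝ) → Matrix κ κ ℝ} {x : ι → ℝ}
    (h : M =ᶠ[nhds x] N) : matDeriv a M x = matDeriv a N x := by
  ext i j
  exact pd_congr (h.mono fun y hy => congrFun (congrFun hy i) j)

variable [Fintype κ]

lemma matDeriv_mul {a : ι} {M N : (ι → ℝ) → Matrix κ κ ℝ} {x : ι → ℝ}
    (hM : ∀ i j, DifferentiableAt ℝ (fun y => M y i j) x)
    (hN : ∀ i j, DifferentiableAt ℝ (fun y => N y i j) x) :
    matDeriv a (fun y => M y * N y) x = matDeriv a M x * N x + M x * matDeriv a N x := by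
  ext i j
  simp only [matDeriv_apply, Matrix.mul_apply, Matrix.add_apply]
  rw [pd_sum fun k _ => (hM i k).fun_mul (hN k j), ← Finset.sum_add_distrib]
  exact Finset.sum_congr rfl fun k _ => pd_mul (hM i k) (hN k j)

variable [DecidableEq κ]

/-- **Jacobi's formula**: the derivative of the determinant is `tr (adj(M) M')`. -/
lemma differentiableAt_and_pd_det {M : (ι → ℝ) → Matrix κ κ ℝ} {x : ι → ℝ}
    (hM : ∀ i j, DifferentiableAt ℝ (fun y => M y i j) x) :
    DifferentiableAt ℝ (fun y => (M y).det) x ∧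
      ∀ a, pd a (fun y => (M y).det) x = ((M x).adjugate * matDeriv a M x).trace := by
  -- the determinant as a continuous multilinear function of the rows
  let d : ContinuousMultilinearMap ℝ (fun _ : κ => κ → ℝ) ℝ :=
    { (Matrix.detRowAlternating (R := ℝ) (n := κ)).toMultilinearMap with
      cont := (continuous_id (X := Matrix κ κ ℝ)).matrix_det }
  let R : (ι → ℝ) → κ → κ → ℝ := fun y i j => M y i j
  have hR : DifferentiableAt ℝ R x :=
    differentiableAt_pi.2 fun i => differentiableAt_pi.2 fun j => hM i j
  have hd := (d.hasFDerivAt (R x)).comp x hR.hasFDerivAt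
  have hd' : HasFDerivAt (fun y => (M y).det)
      ((d.linearDeriv (R x)).comp (fderiv ℝ R x)) x := hd
  refine ⟨hd'.differentiableAt, fun a => ?_⟩
  have hRa : fderiv ℝ R x (Pi.single a 1) = fun i j => matDeriv a M x i j := by
    funext i j
    rw [fderiv_pi fun i => differentiableAt_pi.2 fun j => hM i j]
    simp only [ContinuousLinearMap.coe_pi']
    rw [fderiv_pi fun j => hM i j]
    rfl
  rw [pd, hd'.fderiv, ContinuousLinearMap.comp_apply, hRa,
    ContinuousMultilinearMap.linearDeriv_apply, Matrix.trace_mul_comm, Matrix.trace]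
  refine Finset.sum_congr rfl fun i _ => ?_
  change ((M x).updateRow i (matDeriv a M x i)).det = _
  rw [Matrix.det_eq_sum_mul_adjugate_row _ i, Matrix.diag_apply, Matrix.mul_apply]
  refine Finset.sum_congr rfl fun j _ => ?_
  rw [Matrix.updateRow_self, Matrix.adjugate_apply, Matrix.adjugate_apply, Matrix.updateRow_idem]

lemma differentiableAt_adjugate {M : (ι → ℝ) → Matrix κ κ ℝ} {x : ι → ℝ}
    (hM : ∀ i j, DifferentiableAt ℝ (fun y => M y i j) x) (i j : κ) :
    DifferentiableAt ℝ (fun y => (M y).adjugate i j) x := by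
  simp only [Matrix.adjugate_apply]
  refine (differentiableAt_and_pd_det
    (M := fun y => (M y).updateRow j (Pi.single i 1)) fun k l => ?_).1
  by_cases hk : k = j
  · subst hk
    simp
  · simpa [Matrix.updateRow_ne hk] using hM k l

lemma differentiableAt_inv {M : (ι → ℝ) → Matrix κ κ ℝ} {x : ι → ℝ}
    (hM : ∀ i j, DifferentiableAt ℝ (fun y => M y i j) x) (hdet : (M x).det ≠ 0) (i j : κ) :
    DifferentiableAt ℝ (fun y => (M y)⁻¹ i j) x := by
  simp only [Matrix.inv_def, Matrix.smul_apply, Ring.inverse_eq_inv', smul_eq_mul]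
  exact ((differentiableAt_and_pd_det hM).1.inv hdet).mul (differentiableAt_adjugate hM i j)

lemma eventually_det_ne_zero {M : (ι → ℝ) → Matrix κ κ ℝ} {x : ι → ℝ}
    (hM : ∀ i j, DifferentiableAt ℝ (fun y => M y i j) x) (hdet : (M x).det ≠ 0) :
    ∀ᶠ y in nhds x, (M y).det ≠ 0 :=
  (differentiableAt_and_pd_det hM).1.continuousAt.eventually_ne hdet

lemma matDeriv_inv {M : (ι → ℝ) → Matrix κ κ ℝ} {x : ι → ℝ}
    (hM : ∀ i j, DifferentiableAt ℝ (fun y => M y i j) x) (hdet : (M x).det ≠ 0) (a : ι) :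
    matDeriv a (fun y => (M y)⁻¹) x = -((M x)⁻¹ * matDeriv a M x * (M x)⁻¹) := by
  have h1 := matDeriv_mul (a := a) (differentiableAt_inv hM hdet) hM
  have h2 : matDeriv a (fun y => (M y)⁻¹ * M y) x = 0 := by
    rw [matDeriv_congr (N := fun _ => (1 : Matrix κ κ ℝ))]
    · ext i j
      simp [pd_const]
    · filter_upwards [eventually_det_ne_zero hM hdet] with y hy
      exact Matrix.nonsing_inv_mul _ hy.isUnit
  rw [h2] at h1
  have h3 := congrArg (· * (M x)⁻¹) (eq_neg_of_add_eq_zero_left h1.symm)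
  simpa [Matrix.mul_assoc, Matrix.mul_nonsing_inv _ hdet.isUnit] using h3

lemma matDeriv_adjugate {M : (ι → ℝ) → Matrix κ κ ℝ} {x : ι → ℝ}
    (hM : ∀ i j, DifferentiableAt ℝ (fun y => M y i j) x) (hdet : (M x).det ≠ 0) (a : ι) :
    matDeriv a (fun y => (M y).adjugate) x
      = pd a (fun y => (M y).det) x • (M x)⁻¹ - (M x).adjugate * matDeriv a M x * (M x)⁻¹ := by
  have h1 := matDeriv_mul (a := a) (differentiableAt_adjugate hM) hM
  have h2 : matDeriv a (fun y => (M y).adjugate * M y) x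
      = pd a (fun y => (M y).det) x • (1 : Matrix κ κ ℝ) := by
    ext i j
    simp only [matDeriv_apply, Matrix.adjugate_mul, Matrix.smul_apply, smul_eq_mul]
    rw [pd_mul (differentiableAt_and_pd_det hM).1 (by fun_prop), pd_const]
    simp
  rw [h2] at h1
  have h3 := congrArg (· * (M x)⁻¹) (eq_sub_of_add_eq h1.symm)
  simpa [Matrix.mul_assoc, Matrix.mul_nonsing_inv _ hdet.isUnit, sub_mul] using h3

end MatrixCalculus

/-! ### Functions on the phase space -/

section PhaseSpace

variable {n : ℕ}

/-- The projection `(q, p) ↦ q` as a continuous linear map. -/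
def posL (n : ℕ) : (Fin n ⊕ Fin n → ℝ) →L[ℝ] (Fin n → ℝ) :=
  ContinuousLinearMap.pi fun i => ContinuousLinearMap.proj (Sum.inl i)

lemma differentiable_mom (k : Fin n) : Differentiable ℝ (fun z : Fin n ⊕ Fin n → ℝ => mom z k) :=
  differentiable_apply (Sum.inr k)

lemma differentiableAt_comp_pos {f : (Fin n → ℝ) → ℝ} {z : Fin n ⊕ Fin n → ℝ}
    (hf : DifferentiableAt ℝ f (pos z)) : DifferentiableAt ℝ (fun y => f (pos y)) z :=
  DifferentiableAt.comp z hf (posL n).differentiableAt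

lemma fderiv_comp_pos {f : (Fin n → ℝ) → ℝ} {z : Fin n ⊕ Fin n → ℝ}
    (hf : DifferentiableAt ℝ f (pos z)) (v : Fin n ⊕ Fin n → ℝ) :
    fderiv ℝ (fun y => f (pos y)) z v = fderiv ℝ f (pos z) (pos v) := by
  have h : HasFDerivAt (fun y => f (pos y)) ((fderiv ℝ f (pos z)).comp (posL n)) z :=
    hf.hasFDerivAt.comp z (posL n).hasFDerivAt
  rw [h.fderiv]
  rfl

lemma pd_inl_comp_pos {f : (Fin n → ℝ) → ℝ} {z : Fin n ⊕ Fin n → ℝ}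
    (hf : DifferentiableAt ℝ f (pos z)) (l : Fin n) :
    pd (Sum.inl l) (fun y => f (pos y)) z = pd l f (pos z) := by
  rw [pd, fderiv_comp_pos hf, pd]
  congr 1
  ext i
  simp [pos, Pi.single_apply]

lemma pd_inr_comp_pos {f : (Fin n → ℝ) → ℝ} {z : Fin n ⊕ Fin n → ℝ}
    (hf : DifferentiableAt ℝ f (pos z)) (l : Fin n) :
    pd (Sum.inr l) (fun y => f (pos y)) z = 0 := by
  rw [pd, fderiv_comp_pos hf]
  have h0 : pos (Pi.single (Sum.inr l : Fin n ⊕ Fin n) (1 : ℝ)) = 0 := by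
    ext i
    simp [pos]
  rw [h0, map_zero]

lemma pd_inl_mom (l k : Fin n) (z : Fin n ⊕ Fin n → ℝ) :
    pd (Sum.inl l) (fun y => mom y k) z = 0 := by
  change fderiv ℝ (fun y : Fin n ⊕ Fin n → ℝ => y (Sum.inr k)) z _ = 0
  rw [(hasFDerivAt_apply (Sum.inr k) z).fderiv]
  simp

lemma pd_inr_mom (l k : Fin n) (z : Fin n ⊕ Fin n → ℝ) :
    pd (Sum.inr l) (fun y => mom y k) z = if k = l then 1 else 0 := by
  change fderiv ℝ (fun y : Fin n ⊕ Fin n → ℝ => y (Sum.inr k)) z _ = _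
  rw [(hasFDerivAt_apply (Sum.inr k) z).fderiv]
  simp [Pi.single_apply]

lemma pd_inl_linear_mom {c : Fin n → (Fin n → ℝ) → ℝ} {z : Fin n ⊕ Fin n → ℝ}
    (hc : ∀ k, DifferentiableAt ℝ (c k) (pos z)) (l : Fin n) :
    pd (Sum.inl l) (fun y => ∑ k, c k (pos y) * mom y k) z = ∑ k, pd l (c k) (pos z) * mom z k := by
  rw [pd_sum fun k _ => (differentiableAt_comp_pos (hc k)).fun_mul (differentiable_mom k z)]
  refine Finset.sum_congr rfl fun k _ => ?_
  rw [pd_mul (differentiableAt_comp_pos (hc k)) (differentiable_mom k z), pd_inl_comp_pos (hc k),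
    pd_inl_mom]
  ring

lemma pd_inr_linear_mom {c : Fin n → (Fin n → ℝ) → ℝ} {z : Fin n ⊕ Fin n → ℝ}
    (hc : ∀ k, DifferentiableAt ℝ (c k) (pos z)) (l : Fin n) :
    pd (Sum.inr l) (fun y => ∑ k, c k (pos y) * mom y k) z = c l (pos z) := by
  rw [pd_sum fun k _ => (differentiableAt_comp_pos (hc k)).fun_mul (differentiable_mom k z),
    Finset.sum_eq_single l]
  · rw [pd_mul (differentiableAt_comp_pos (hc l)) (differentiable_mom l z),
      pd_inr_comp_pos (hc l), pd_inr_mom]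
    simp
  · intro k _ hk
    rw [pd_mul (differentiableAt_comp_pos (hc k)) (differentiable_mom k z),
      pd_inr_comp_pos (hc k), pd_inr_mom]
    simp [hk]
  · simp

end PhaseSpace

/-! ### The Levi-Civita connection and `J`-tensors on a coordinate domain -/

section Local

variable {n : ℕ}

/-- `g` is the component matrix of a smooth pseudo-Riemannian metric on the open set `D`. -/
structure IsMetricOn (D : Set (Fin n → ℝ)) (g : (Fin n → ℝ) → Matrix (Fin n) (Fin n) ℝ) :
    Prop where
  isOpen : IsOpen D
  smooth : ∀ i j, ContDiffOn ℝ ∞ (fun q => g q i j) D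
  symm : ∀ q ∈ D, (g q)ᵀ = g q
  det_ne_zero : ∀ q ∈ D, (g q).det ≠ 0

/-- `J` is the component matrix of a smooth `J`-tensor of `g` on `D`, and `α` is the corresponding
`1`-form. -/
structure IsJTensorOn (D : Set (Fin n → ℝ)) (g J : (Fin n → ℝ) → Matrix (Fin n) (Fin n) ℝ)
    (α : (Fin n → ℝ) → Fin n → ℝ) : Prop where
  smooth : ∀ i j, ContDiffOn ℝ ∞ (fun q => J q i j) D
  symm : ∀ q ∈ D, (J q * (g q)⁻¹)ᵀ = J q * (g q)⁻¹
  characteristic : ∀ q ∈ D, ∀ h i j, covDeriv g J q h i j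
    = α q j * (if i = h then 1 else 0) + ((g q)⁻¹ *ᵥ α q) i * g q j h

/-- The connection matrix `Γ_h`, with entry `Γⁱₕₗ` in row `i` and column `l`. -/
def connectionMatrix (g : (Fin n → ℝ) → Matrix (Fin n) (Fin n) ℝ) (q : Fin n → ℝ) (h : Fin n) :
    Matrix (Fin n) (Fin n) ℝ :=
  Matrix.of fun i l => christoffel g q i h l

variable {D : Set (Fin n → ℝ)} {g J J₁ J₂ : (Fin n → ℝ) → Matrix (Fin n) (Fin n) ℝ}
  {α α₁ α₂ : (Fin n → ℝ) → Fin n → ℝ} {q : Fin n → ℝ}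

namespace IsMetricOn

variable (hg : IsMetricOn D g)
include hg

lemma differentiableAt (hq : q ∈ D) (i j : Fin n) : DifferentiableAt ℝ (fun x => g x i j) q :=
  differentiableAt_of_contDiffOn hg.isOpen (hg.smooth i j) hq

lemma inv_mul (hq : q ∈ D) : (g q)⁻¹ * g q = 1 :=
  Matrix.nonsing_inv_mul _ (hg.det_ne_zero q hq).isUnit

lemma mul_inv (hq : q ∈ D) : g q * (g q)⁻¹ = 1 :=
  Matrix.mul_nonsing_inv _ (hg.det_ne_zero q hq).isUnit

lemma inv_symm (hq : q ∈ D) : ((g q)⁻¹)ᵀ = (g q)⁻¹ := by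
  rw [Matrix.transpose_nonsing_inv, hg.symm q hq]

lemma pd_symm (hq : q ∈ D) (h i j : Fin n) :
    pd h (fun x => g x i j) q = pd h (fun x => g x j i) q := by
  refine pd_congr ?_
  filter_upwards [hg.isOpen.mem_nhds hq] with x hx
  exact congrFun (congrFun (hg.symm x hx) j) i

/-- The Levi-Civita connection is torsion-free. -/
lemma christoffel_symm (hq : q ∈ D) (i j k : Fin n) :
    christoffel g q i j k = christoffel g q i k j := by
  simp only [christoffel]
  congr 1
  refine Finset.sum_congr rfl fun l _ => ?_
  rw [hg.pd_symm hq l j k]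
  ring

lemma connectionMatrix_symm (hq : q ∈ D) (i j k : Fin n) :
    connectionMatrix g q j i k = connectionMatrix g q k i j :=
  hg.christoffel_symm hq i j k

lemma mul_connectionMatrix (hq : q ∈ D) (h m l : Fin n) :
    (g q * connectionMatrix g q h) m l = (1 / 2) * (pd h (fun x => g x l m) q
      + pd l (fun x => g x h m) q - pd m (fun x => g x h l) q) := by
  have h1 : connectionMatrix g q h = (g q)⁻¹ * Matrix.of fun m l =>
      (1 / 2) * (pd h (fun x => g x l m) q + pd l (fun x => g x h m) q
        - pd m (fun x => g x h l) q) := by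
    ext i l
    simp only [connectionMatrix, christoffel, Matrix.of_apply, Matrix.mul_apply, Finset.mul_sum]
    refine Finset.sum_congr rfl fun m _ => ?_
    ring
  rw [h1, ← Matrix.mul_assoc, hg.mul_inv hq, Matrix.one_mul, Matrix.of_apply]

/-- The Levi-Civita connection is metric: `∂ₕ g = g Γₕ + Γₕᵀ g`. -/
lemma matDeriv_eq (hq : q ∈ D) (h : Fin n) :
    matDeriv h g q = g q * connectionMatrix g q h + (connectionMatrix g q h)ᵀ * g q := by
  have h1 : (connectionMatrix g q h)ᵀ * g q = (g q * connectionMatrix g q h)ᵀ := by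
    rw [Matrix.transpose_mul, hg.symm q hq]
  ext i j
  rw [h1, Matrix.add_apply, Matrix.transpose_apply, hg.mul_connectionMatrix hq,
    hg.mul_connectionMatrix hq, matDeriv_apply, hg.pd_symm hq h j i]
  ring

lemma matDeriv_inv_eq (hq : q ∈ D) (h : Fin n) :
    matDeriv h (fun x => (g x)⁻¹) q
      = -(connectionMatrix g q h * (g q)⁻¹ + (g q)⁻¹ * (connectionMatrix g q h)ᵀ) := by
  rw [matDeriv_inv (hg.differentiableAt hq) (hg.det_ne_zero q hq), hg.matDeriv_eq hq,
    Matrix.mul_add, Matrix.add_mul, ← Matrix.mul_assoc, hg.inv_mul hq, Matrix.one_mul,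
    ← Matrix.mul_assoc, Matrix.mul_assoc _ (g q), hg.mul_inv hq, Matrix.mul_one]

end IsMetricOn

namespace IsJTensorOn

lemma differentiableAt (hJ : IsJTensorOn D g J α) (hg : IsMetricOn D g) (hq : q ∈ D)
    (i j : Fin n) : DifferentiableAt ℝ (fun x => J x i j) q :=
  differentiableAt_of_contDiffOn hg.isOpen (hJ.smooth i j) hq

lemma mul_inv_eq (hJ : IsJTensorOn D g J α) (hg : IsMetricOn D g) (hq : q ∈ D) :
    (g q)⁻¹ * (J q)ᵀ = J q * (g q)⁻¹ := by
  have h := hJ.symm q hq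
  rwa [Matrix.transpose_mul, hg.inv_symm hq] at h

/-- `J` is self-adjoint with respect to `g`. -/
lemma mul_eq_transpose_mul (hJ : IsJTensorOn D g J α) (hg : IsMetricOn D g) (hq : q ∈ D) :
    g q * J q = (J q)ᵀ * g q := by
  calc g q * J q = g q * (J q * (g q)⁻¹) * g q := by
        rw [Matrix.mul_assoc, Matrix.mul_assoc, hg.inv_mul hq, Matrix.mul_one]
    _ = (J q)ᵀ * g q := by
        rw [← hJ.mul_inv_eq hg hq, ← Matrix.mul_assoc, hg.mul_inv hq, Matrix.one_mul]

/-- The equation of a `J`-tensor, solved for the partial derivatives. -/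
lemma matDeriv_eq (hJ : IsJTensorOn D g J α) (hq : q ∈ D) (h : Fin n) :
    matDeriv h J q = J q * connectionMatrix g q h - connectionMatrix g q h * J q
      + Matrix.vecMulVec (Pi.single h 1) (α q)
      + Matrix.vecMulVec ((g q)⁻¹ *ᵥ α q) (g q *ᵥ Pi.single h 1) := by
  ext i j
  have h1 := hJ.characteristic q hq h i j
  have h2 : ∑ l, christoffel g q l h j * J q i l = ∑ l, J q i l * christoffel g q l h j :=
    Finset.sum_congr rfl fun l _ => mul_comm _ _
  simp only [covDeriv, h2] at h1
  simp only [matDeriv_apply, Matrix.add_apply, Matrix.sub_apply, Matrix.mul_apply,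
    Matrix.vecMulVec_apply, connectionMatrix, Matrix.of_apply, Matrix.mulVec_single_one,
    Matrix.col_apply, Pi.single_apply]
  linarith

/-- The equation of a `J`-tensor is linear, for a fixed metric. -/
lemma linearCombination (hg : IsMetricOn D g) (h₁ : IsJTensorOn D g J₁ α₁)
    (h₂ : IsJTensorOn D g J₂ α₂) (c₁ c₂ : ℝ) :
    IsJTensorOn D g (fun x => c₁ • J₁ x + c₂ • J₂ x) (fun x => c₁ • α₁ x + c₂ • α₂ x) where
  smooth i j := (contDiffOn_const.mul (h₁.smooth i j)).add (contDiffOn_const.mul (h₂.smooth i j))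
  symm x hx := by
    rw [Matrix.add_mul, Matrix.smul_mul, Matrix.smul_mul, Matrix.transpose_add,
      Matrix.transpose_smul, Matrix.transpose_smul, h₁.symm x hx, h₂.symm x hx]
  characteristic x hx h i j := by
    have e₁ := h₁.characteristic x hx h i j
    have e₂ := h₂.characteristic x hx h i j
    have hp : pd h (fun y => (c₁ • J₁ y + c₂ • J₂ y) i j) x
        = c₁ * pd h (fun y => J₁ y i j) x + c₂ * pd h (fun y => J₂ y i j) x :=
      pd_linearCombination (h₁.differentiableAt hg hx i j) (h₂.differentiableAt hg hx i j) c₁ c₂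
    simp only [covDeriv] at e₁ e₂ ⊢
    rw [hp]
    simp only [Matrix.add_apply, Matrix.smul_apply, smul_eq_mul, mul_add, Pi.add_apply,
      Pi.smul_apply, Matrix.mulVec_add, Matrix.mulVec_smul, Finset.sum_add_distrib,
      mul_left_comm _ c₁, mul_left_comm _ c₂, ← Finset.mul_sum]
    linear_combination c₁ * e₁ + c₂ * e₂

end IsJTensorOn

end Local

/-! ### The Nijenhuis torsion and the Poisson property -/

section Poisson

variable {n : ℕ}

/-- The Nijenhuis torsion of a `(1,1)`-tensor, up to sign:
`Jⁱₗ (∂ₖ Jˡⱼ - ∂ⱼ Jˡₖ) + Jˡⱼ ∂ₗ Jⁱₖ - Jˡₖ ∂ₗ Jⁱⱼ`. -/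
def torsion (J : (Fin n → ℝ) → Matrix (Fin n) (Fin n) ℝ) (q : Fin n → ℝ) (i j k : Fin n) : ℝ :=
  ∑ l, (J q i l * (pd k (fun x => J x l j) q - pd j (fun x => J x l k) q)
    + J q l j * pd l (fun x => J x i k) q - J q l k * pd l (fun x => J x i j) q)

variable {D : Set (Fin n → ℝ)} {g J : (Fin n → ℝ) → Matrix (Fin n) (Fin n) ℝ}
  {α : (Fin n → ℝ) → Fin n → ℝ} {q : Fin n → ℝ}

/-- The torsion of a `J`-tensor vanishes: the connection is torsion-free, so partial derivatives
may be replaced by covariant ones, and the terms with `α` cancel since `J` is self-adjoint. -/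
lemma IsJTensorOn.torsion_eq_zero (hJ : IsJTensorOn D g J α) (hg : IsMetricOn D g) (hq : q ∈ D)
    (i j k : Fin n) : torsion J q i j k = 0 := by
  set C := connectionMatrix g q with hC
  have hsymm : ∀ a b c, C b a c = C c a b := hg.connectionMatrix_symm hq
  have hgs : ∀ a b, g q a b = g q b a := fun a b => congrFun (congrFun (hg.symm q hq) b) a
  -- the two contractions that occur in the torsion
  have hA : ∀ j k, ∑ l, J q i l * pd k (fun x => J x l j) q
      = (J q * (J q * C k)) i j - (J q * (C k * J q)) i j + J q i k * α q j
        + (J q *ᵥ ((g q)⁻¹ *ᵥ α q)) i * g q j k := fun j k => by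
    change (J q * matDeriv k J q) i j = _
    rw [hJ.matDeriv_eq hq k, Matrix.mul_add, Matrix.mul_add, Matrix.mul_sub,
      Matrix.mul_vecMulVec, Matrix.mul_vecMulVec]
    simp [Matrix.vecMulVec_apply, ← hC]
  have hB : ∀ j k, ∑ l, J q l j * pd l (fun x => J x i k) q
      = (J q * (C k * J q)) i j - ∑ l, ∑ m, J q l j * (C l i m * J q m k) + J q i j * α q k
        + ((g q)⁻¹ *ᵥ α q) i * (g q * J q) k j := fun j k => by
    have h1 : ∀ l, pd l (fun x => J x i k) q = ∑ m, J q i m * C k m l - ∑ m, C l i m * J q m k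
        + (Pi.single l 1 : Fin n → ℝ) i * α q k + ((g q)⁻¹ *ᵥ α q) i * g q k l := fun l => by
      change matDeriv l J q i k = _
      rw [hJ.matDeriv_eq hq l]
      simp [Matrix.vecMulVec_apply, Matrix.mul_apply, ← hC, hsymm _ l k]
    simp only [h1, mul_add, mul_sub, Finset.sum_add_distrib, Finset.sum_sub_distrib]
    congr 2
    · congr 1
      · simp only [Matrix.mul_apply, Finset.mul_sum]
        rw [Finset.sum_comm]
        exact Finset.sum_congr rfl fun _ _ => Finset.sum_congr rfl fun _ _ => by ring
      · simp only [Finset.mul_sum]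
    · simp [Pi.single_apply]
    · simp only [Matrix.mul_apply, Finset.mul_sum]
      exact Finset.sum_congr rfl fun _ _ => by ring
  have h1 : (J q * (J q * C k)) i j = (J q * (J q * C j)) i k := by
    simp only [Matrix.mul_apply, hsymm _ k j]
  have h2 : ∑ l, ∑ m, J q l j * (C l i m * J q m k) = ∑ l, ∑ m, J q l k * (C l i m * J q m j) := by
    rw [Finset.sum_comm]
    refine Finset.sum_congr rfl fun l _ => Finset.sum_congr rfl fun m _ => ?_
    rw [hsymm _ m l]
    ring
  have h3 : (g q * J q) k j = (g q * J q) j k := by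
    have h4 : (g q * J q)ᵀ = g q * J q := by
      rw [Matrix.transpose_mul, hg.symm q hq, hJ.mul_eq_transpose_mul hg hq]
    exact congrFun (congrFun h4 j) k
  simp only [torsion, mul_sub, Finset.sum_add_distrib, Finset.sum_sub_distrib, hA, hB]
  rw [h1, h2, h3, hgs j k]
  ring

/-- The coefficient `∂ⱼ Jᵏᵢ - ∂ᵢ Jᵏⱼ` of `pₖ` in the entry of `Ω` in row `i` and column `j`. -/
def omegaCoeff (J : (Fin n → ℝ) → Matrix (Fin n) (Fin n) ℝ) (i j k : Fin n) (x : Fin n → ℝ) : ℝ :=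
  pd j (fun y => J y k i) x - pd i (fun y => J y k j) x

lemma Omega_eq (z : Fin n ⊕ Fin n → ℝ) (i j : Fin n) :
    Omega J z i j = ∑ k, omegaCoeff J i j k (pos z) * mom z k := rfl

lemma isOpen_pos_preimage (hD : IsOpen D) : IsOpen {z : Fin n ⊕ Fin n → ℝ | pos z ∈ D} :=
  hD.preimage (posL n).continuous

lemma contDiffOn_comp_pos {f : (Fin n → ℝ) → ℝ} (hf : ContDiffOn ℝ ∞ f D) :
    ContDiffOn ℝ ∞ (fun z : Fin n ⊕ Fin n → ℝ => f (pos z)) {z | pos z ∈ D} :=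
  hf.comp (posL n).contDiff.contDiffOn fun _ hz => hz

lemma contDiffOn_omegaCoeff (hD : IsOpen D) (hJ : ∀ i j, ContDiffOn ℝ ∞ (fun x => J x i j) D)
    (i j k : Fin n) : ContDiffOn ℝ ∞ (omegaCoeff J i j k) D :=
  (contDiffOn_pd hD (hJ k i) j).sub (contDiffOn_pd hD (hJ k j) i)

lemma contDiffOn_PiNC (hD : IsOpen D) (hJ : ∀ i j, ContDiffOn ℝ ∞ (fun x => J x i j) D)
    (a b : Fin n ⊕ Fin n) : ContDiffOn ℝ ∞ (fun z => PiNC J z a b) {z | pos z ∈ D} := by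
  rcases a with i | i <;> rcases b with j | j
  · exact contDiffOn_const
  · exact contDiffOn_comp_pos (hJ i j)
  · exact (contDiffOn_comp_pos (hJ j i)).neg
  · change ContDiffOn ℝ ∞ (fun z => ∑ k, omegaCoeff J i j k (pos z) * mom z k) _
    refine ContDiffOn.sum fun k _ =>
      (contDiffOn_comp_pos (contDiffOn_omegaCoeff hD hJ i j k)).mul ?_
    exact (contDiff_apply ℝ ℝ (Sum.inr k)).contDiffOn

lemma Omega_swap (z : Fin n ⊕ Fin n → ℝ) (i j : Fin n) : Omega J z j i = -Omega J z i j := by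
  rw [Omega_eq, Omega_eq, ← Finset.sum_neg_distrib]
  refine Finset.sum_congr rfl fun k _ => ?_
  simp only [omegaCoeff]
  ring

lemma PiNC_transpose (z : Fin n ⊕ Fin n → ℝ) : (PiNC J z)ᵀ = -PiNC J z := by
  ext a b
  rcases a with i | i <;> rcases b with j | j
  · simp [PiNC]
  · simp [PiNC]
  · simp [PiNC]
  · simp [PiNC, Omega_swap z i j]

/-- The contribution of the indices `a`, `b`, `c` to the Jacobi identity of `P`, before cyclic
summation. -/
def jacobiTerm {ι : Type*} [Fintype ι] [DecidableEq ι] (P : (ι → ℝ) → Matrix ι ι ℝ) (z : ι → ℝ)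
    (a b c : ι) : ℝ :=
  ∑ d, P z a d * pd d (fun y => P y b c) z

section JacobiTerms

variable {z : Fin n ⊕ Fin n → ℝ} (i j k : Fin n)

lemma jacobiTerm_inl_inl (a : Fin n ⊕ Fin n) :
    jacobiTerm (PiNC J) z a (Sum.inl j) (Sum.inl k) = 0 :=
  Finset.sum_eq_zero fun d _ => by
    change _ * pd d (fun _ => (0 : ℝ)) z = 0
    rw [pd_const, mul_zero]

variable (hJ : ∀ i j, DifferentiableAt ℝ (fun x => J x i j) (pos z))
include hJ

lemma jacobiTerm_inl_inl_inr :
    jacobiTerm (PiNC J) z (Sum.inl i) (Sum.inl j) (Sum.inr k) = 0 := by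
  simp only [jacobiTerm, Fintype.sum_sum_type]
  simp only [PiNC, Matrix.fromBlocks_apply₁₁, Matrix.fromBlocks_apply₁₂, Matrix.zero_apply,
    pd_inr_comp_pos (hJ j k)]
  simp

lemma jacobiTerm_inr_inl_inr : jacobiTerm (PiNC J) z (Sum.inr i) (Sum.inl j) (Sum.inr k)
    = -∑ l, J (pos z) l i * pd l (fun x => J x j k) (pos z) := by
  simp only [jacobiTerm, Fintype.sum_sum_type]
  simp only [PiNC, Matrix.fromBlocks_apply₂₁, Matrix.fromBlocks_apply₁₂, Matrix.fromBlocks_apply₂₂,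
    pd_inr_comp_pos (hJ j k), pd_inl_comp_pos (hJ j k)]
  simp

omit hJ in
/-- Two entries of `Π_nc(J)` in transposed positions are opposite. -/
lemma jacobiTerm_swap (a b c : Fin n ⊕ Fin n) :
    jacobiTerm (PiNC J) z a c b = -jacobiTerm (PiNC J) z a b c := by
  have h : ∀ y, PiNC J y c b = -PiNC J y b c := fun y =>
    congrFun (congrFun (PiNC_transpose (J := J) y) b) c
  simp only [jacobiTerm, h, pd_neg, mul_neg, Finset.sum_neg_distrib]

variable (hω : ∀ i j k, DifferentiableAt ℝ (omegaCoeff J i j k) (pos z))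
include hω

omit hJ in
lemma jacobiTerm_inl_inr_inr : jacobiTerm (PiNC J) z (Sum.inl i) (Sum.inr j) (Sum.inr k)
    = ∑ l, J (pos z) i l * omegaCoeff J j k l (pos z) := by
  simp only [jacobiTerm, Fintype.sum_sum_type]
  simp only [PiNC, Matrix.fromBlocks_apply₁₁, Matrix.fromBlocks_apply₁₂, Matrix.fromBlocks_apply₂₂,
    Omega_eq, pd_inr_linear_mom (hω j k)]
  simp

omit hJ in
lemma jacobiTerm_inr_inr_inr : jacobiTerm (PiNC J) z (Sum.inr i) (Sum.inr j) (Sum.inr k)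
    = ∑ m, mom z m * ∑ l, (omegaCoeff J i l m (pos z) * omegaCoeff J j k l (pos z)
      - J (pos z) l i * pd l (omegaCoeff J j k m) (pos z)) := by
  simp only [jacobiTerm, Fintype.sum_sum_type]
  simp only [PiNC, Matrix.fromBlocks_apply₂₁, Matrix.fromBlocks_apply₂₂,
    Omega_eq, pd_inr_linear_mom (hω j k), pd_inl_linear_mom (hω j k), Finset.mul_sum,
    Finset.sum_mul, Matrix.neg_apply, Matrix.transpose_apply, ← Finset.sum_add_distrib]
  rw [Finset.sum_comm]
  exact Finset.sum_congr rfl fun _ _ => Finset.sum_congr rfl fun _ _ => by ring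

end JacobiTerms

section Torsion

variable (hD : IsOpen D) (hJ : ∀ i j, ContDiffOn ℝ ∞ (fun x => J x i j) D) (hq : q ∈ D)
include hD hJ hq

lemma pd_omegaCoeff (a i j k : Fin n) : pd a (omegaCoeff J i j k) q
    = pd a (pd j (fun y => J y k i)) q - pd a (pd i (fun y => J y k j)) q :=
  pd_sub (differentiableAt_of_contDiffOn hD (contDiffOn_pd hD (hJ _ _) _) hq)
    (differentiableAt_of_contDiffOn hD (contDiffOn_pd hD (hJ _ _) _) hq)

lemma pd_torsion (a i j k : Fin n) : pd a (fun x => torsion J x i j k) q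
    = ∑ l, (pd a (fun x => J x i l) q
          * (pd k (fun x => J x l j) q - pd j (fun x => J x l k) q)
        + J q i l * (pd a (pd k (fun x => J x l j)) q - pd a (pd j (fun x => J x l k)) q)
        + (pd a (fun x => J x l j) q * pd l (fun x => J x i k) q
          + J q l j * pd a (pd l (fun x => J x i k)) q)
        - (pd a (fun x => J x l k) q * pd l (fun x => J x i j) q
          + J q l k * pd a (pd l (fun x => J x i j)) q)) := by
  have d0 : ∀ i j, DifferentiableAt ℝ (fun x => J x i j) q := fun i j =>
    differentiableAt_of_contDiffOn hD (hJ i j) hq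
  have d1 : ∀ a i j, DifferentiableAt ℝ (pd a (fun x => J x i j)) q := fun a i j =>
    differentiableAt_of_contDiffOn hD (contDiffOn_pd hD (hJ i j) a) hq
  simp only [torsion]
  have e1 := fun l => (d0 i l).fun_mul ((d1 k l j).fun_sub (d1 j l k))
  have e2 := fun l => (d0 l j).fun_mul (d1 l i k)
  have e3 := fun l => (d0 l k).fun_mul (d1 l i j)
  rw [pd_sum fun l _ => ((e1 l).fun_add (e2 l)).fun_sub (e3 l)]
  refine Finset.sum_congr rfl fun l _ => ?_
  rw [pd_sub ((e1 l).fun_add (e2 l)) (e3 l), pd_add (e1 l) (e2 l),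
    pd_mul (d0 i l) ((d1 k l j).fun_sub (d1 j l k)), pd_sub (d1 k l j) (d1 j l k),
    pd_mul (d0 l j) (d1 l i k), pd_mul (d0 l k) (d1 l i j)]

/-- The Jacobi identity for three momenta is the differential consequence
`∂ₐ Nᵐ_{bc} + ∂_b Nᵐ_{ca} + ∂_c Nᵐ_{ab} = 0` of the vanishing of the torsion `N`. -/
lemma sum_omegaCoeff_eq_pd_torsion (a b c m : Fin n) :
    ∑ l, (omegaCoeff J a l m q * omegaCoeff J b c l q - J q l a * pd l (omegaCoeff J b c m) q)
      + ∑ l, (omegaCoeff J b l m q * omegaCoeff J c a l q - J q l b * pd l (omegaCoeff J c a m) q)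
      + ∑ l, (omegaCoeff J c l m q * omegaCoeff J a b l q - J q l c * pd l (omegaCoeff J a b m) q)
    = -(pd a (fun x => torsion J x m b c) q + pd b (fun x => torsion J x m c a) q
      + pd c (fun x => torsion J x m a b) q) := by
  have hc : ∀ a b i j, pd a (pd b fun x => J x i j) q = pd b (pd a fun x => J x i j) q :=
    fun a b i j => pd_comm ((hJ i j).contDiffAt (hD.mem_nhds hq))
  simp only [pd_torsion hD hJ hq, pd_omegaCoeff hD hJ hq, ← Finset.sum_add_distrib,
    ← Finset.sum_neg_distrib]
  refine Finset.sum_congr rfl fun l _ => ?_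
  simp only [omegaCoeff]
  rw [hc b a, hc c a, hc c b, hc a l, hc b l, hc c l, hc a l, hc b l, hc c l]
  ring

end Torsion

/-- A torsionless `(1,1)`-tensor `J` induces the Poisson operator `Π_nc(J)`. -/
lemma isPoissonOn_PiNC (hD : IsOpen D) (hJ : ∀ i j, ContDiffOn ℝ ∞ (fun x => J x i j) D)
    (hN : ∀ q ∈ D, ∀ i j k, torsion J q i j k = 0) :
    IsPoissonOn {z : Fin n ⊕ Fin n → ℝ | pos z ∈ D} (PiNC J) where
  smooth := contDiffOn_PiNC hD hJ
  skew z _ := PiNC_transpose z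
  jacobi z hz := by
    have d0 : ∀ i j, DifferentiableAt ℝ (fun x => J x i j) (pos z) := fun i j =>
      differentiableAt_of_contDiffOn hD (hJ i j) hz
    have d1 : ∀ i j k, DifferentiableAt ℝ (omegaCoeff J i j k) (pos z) := fun i j k =>
      differentiableAt_of_contDiffOn hD (contDiffOn_omegaCoeff hD hJ i j k) hz
    have hN' : ∀ a i j k, pd a (fun x => torsion J x i j k) (pos z) = 0 := fun a i j k => by
      rw [← pd_const a 0 (pos z)]
      refine pd_congr ?_
      filter_upwards [hD.mem_nhds hz] with x hx using hN x hx i j k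
    -- two momenta and one position: the torsion itself
    have mixed : ∀ i j k : Fin n, jacobiTerm (PiNC J) z (Sum.inl i) (Sum.inr j) (Sum.inr k)
        + jacobiTerm (PiNC J) z (Sum.inr j) (Sum.inr k) (Sum.inl i)
        + jacobiTerm (PiNC J) z (Sum.inr k) (Sum.inl i) (Sum.inr j) = 0 := fun i j k => by
      rw [jacobiTerm_swap (Sum.inr j), jacobiTerm_inl_inr_inr i j k d1,
        jacobiTerm_inr_inl_inr j i k d0, jacobiTerm_inr_inl_inr k i j d0, neg_neg,
        ← hN (pos z) hz i j k]
      simp only [torsion, Finset.sum_add_distrib, Finset.sum_sub_distrib, omegaCoeff]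
      ring
    have main : ∀ a b c, jacobiTerm (PiNC J) z a b c + jacobiTerm (PiNC J) z b c a
        + jacobiTerm (PiNC J) z c a b = 0 := by
      rintro (i | i) (j | j) (k | k)
      · simp only [jacobiTerm_inl_inl, add_zero]
      · rw [jacobiTerm_swap (Sum.inl j)]
        simp only [jacobiTerm_inl_inl, jacobiTerm_inl_inl_inr _ _ _ d0, add_zero, neg_zero]
      · rw [jacobiTerm_swap (Sum.inl i)]
        simp only [jacobiTerm_inl_inl, jacobiTerm_inl_inl_inr _ _ _ d0, add_zero, neg_zero]
      · exact mixed i j k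
      · rw [jacobiTerm_swap (Sum.inl k)]
        simp only [jacobiTerm_inl_inl, jacobiTerm_inl_inl_inr _ _ _ d0, add_zero, neg_zero]
      · linear_combination mixed j k i
      · linear_combination mixed k i j
      -- three momenta: a linear form in `p` whose coefficients are derivatives of the torsion
      · simp only [jacobiTerm_inr_inr_inr _ _ _ d1, ← Finset.sum_add_distrib, ← mul_add]
        refine Finset.sum_eq_zero fun m _ => ?_
        rw [Finset.sum_add_distrib, Finset.sum_add_distrib,
          sum_omegaCoeff_eq_pd_torsion hD hJ hz, hN', hN', hN']
        simp
    intro a b c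
    simpa only [jacobiTerm, ← Finset.sum_add_distrib] using main a b c

/-- `Π_nc` is linear in the `(1,1)`-tensor. -/
lemma PiNC_linearCombination {J₁ J₂ : (Fin n → ℝ) → Matrix (Fin n) (Fin n) ℝ}
    {z : Fin n ⊕ Fin n → ℝ} (h₁ : ∀ i j, DifferentiableAt ℝ (fun x => J₁ x i j) (pos z))
    (h₂ : ∀ i j, DifferentiableAt ℝ (fun x => J₂ x i j) (pos z)) (c₁ c₂ : ℝ) :
    PiNC (fun x => c₁ • J₁ x + c₂ • J₂ x) z = c₁ • PiNC J₁ z + c₂ • PiNC J₂ z := by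
  have hΩ : Omega (fun x => c₁ • J₁ x + c₂ • J₂ x) z = c₁ • Omega J₁ z + c₂ • Omega J₂ z := by
    ext i j
    simp only [Omega, Matrix.of_apply, Matrix.add_apply, Matrix.smul_apply, smul_eq_mul,
      Finset.mul_sum, ← Finset.sum_add_distrib]
    refine Finset.sum_congr rfl fun k _ => ?_
    rw [pd_linearCombination (h₁ k i) (h₂ k i), pd_linearCombination (h₁ k j) (h₂ k j)]
    ring
  ext a b
  rcases a with i | i <;> rcases b with j | j
  · simp [PiNC]
  · simp [PiNC]
  · simp [PiNC]
    ring
  · simp [PiNC, hΩ]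

lemma IsPoissonOn.congr {ι : Type*} [Fintype ι] [DecidableEq ι] {U : Set (ι → ℝ)} (hU : IsOpen U)
    {P P' : (ι → ℝ) → Matrix ι ι ℝ} (hP : IsPoissonOn U P) (h : ∀ z ∈ U, P' z = P z) :
    IsPoissonOn U P' where
  smooth a b := (hP.smooth a b).congr fun z hz => by rw [h z hz]
  skew z hz := by rw [h z hz, hP.skew z hz]
  jacobi z hz a b c := by
    have hpd : ∀ d a b, pd d (fun y => P' y a b) z = pd d (fun y => P y a b) z := fun d a b =>
      pd_congr (by
        filter_upwards [hU.mem_nhds hz] with y hy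
        exact congrFun (congrFun (h y hy) a) b)
    simp only [h z hz, hpd]
    exact hP.jacobi z hz a b c

/-- For `J`-tensors `J₁`, `J₂` of the same metric, `Π_nc(J₁)` and `Π_nc(J₂)` are compatible, since
every linear combination of `J₁` and `J₂` is again a `J`-tensor. -/
lemma areCompatiblePoissonOn_PiNC {J₁ J₂ : (Fin n → ℝ) → Matrix (Fin n) (Fin n) ℝ}
    {α₁ α₂ : (Fin n → ℝ) → Fin n → ℝ} (hg : IsMetricOn D g) (h₁ : IsJTensorOn D g J₁ α₁)
    (h₂ : IsJTensorOn D g J₂ α₂) :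
    AreCompatiblePoissonOn {z : Fin n ⊕ Fin n → ℝ | pos z ∈ D} (PiNC J₁) (PiNC J₂) := by
  intro c₁ c₂
  have h := h₁.linearCombination hg h₂ c₁ c₂
  refine (isPoissonOn_PiNC hg.isOpen h.smooth fun q hq => h.torsion_eq_zero hg hq).congr
    (isOpen_pos_preimage hg.isOpen) fun z hz => ?_
  rw [PiNC_linearCombination (h₁.differentiableAt hg hz) (h₂.differentiableAt hg hz)]

end Poisson

/-! ### The quasi-Hamiltonian vector field -/

section HamiltonianField

variable {n : ℕ} {D : Set (Fin n → ℝ)} {g J : (Fin n → ℝ) → Matrix (Fin n) (Fin n) ℝ}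
  {α : (Fin n → ℝ) → Fin n → ℝ} {q p : Fin n → ℝ}

lemma mulVec_dotProduct (M : Matrix (Fin n) (Fin n) ℝ) (x y : Fin n → ℝ) :
    (M *ᵥ x) ⬝ᵥ y = x ⬝ᵥ (Mᵀ *ᵥ y) := by
  rw [Matrix.mulVec_transpose, dotProduct_comm, Matrix.dotProduct_mulVec, dotProduct_comm]

lemma dotProduct_vecMulVec_mulVec (x u v y : Fin n → ℝ) :
    x ⬝ᵥ (Matrix.vecMulVec u v *ᵥ y) = (x ⬝ᵥ u) * (v ⬝ᵥ y) := by
  rw [Matrix.vecMulVec_mulVec]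
  simp [mul_comm]

/-- The vector field of the Newton system `∇_q̇ q̇ = F` in the coordinates `(q, p)`, `p = g q̇`:
`q̇ = G p` and `ṗᵢ = Γᵏᵢₗ q̇ˡ pₖ + gᵢₗ Fˡ`. -/
def newtonField (g : (Fin n → ℝ) → Matrix (Fin n) (Fin n) ℝ) (F : (Fin n → ℝ) → Fin n → ℝ)
    (z : Fin n ⊕ Fin n → ℝ) : Fin n ⊕ Fin n → ℝ :=
  Sum.elim ((g (pos z))⁻¹ *ᵥ mom z) fun i =>
    mom z ⬝ᵥ (connectionMatrix g (pos z) i *ᵥ ((g (pos z))⁻¹ *ᵥ mom z))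
      + (g (pos z) *ᵥ F (pos z)) i

lemma adjugate_eq_det_smul_inv {M : Matrix (Fin n) (Fin n) ℝ} (h : M.det ≠ 0) :
    M.adjugate = M.det • M⁻¹ := by
  rw [Matrix.inv_def, smul_smul, Ring.inverse_eq_inv', mul_inv_cancel₀ h, one_smul]

lemma adjugate_inv_eq {M : Matrix (Fin n) (Fin n) ℝ} (h : M.det ≠ 0) :
    M.adjugate⁻¹ = M.det⁻¹ • M := by
  refine Matrix.inv_eq_left_inv ?_
  rw [Matrix.smul_mul, Matrix.mul_adjugate, smul_smul, inv_mul_cancel₀ h, one_smul]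

namespace IsJTensorOn

/-- `J⁻¹ G` is symmetric. -/
lemma inv_mul_inv_symm (hJ : IsJTensorOn D g J α) (hg : IsMetricOn D g) (hq : q ∈ D) :
    ((J q)⁻¹ * (g q)⁻¹)ᵀ = (J q)⁻¹ * (g q)⁻¹ := by
  rw [← Matrix.mul_inv_rev, Matrix.transpose_nonsing_inv, Matrix.transpose_mul, hg.symm q hq,
    hJ.mul_eq_transpose_mul hg hq]

/-- `dσ = 2 σ J⁻ᵀ α` for `σ = det J`. -/
lemma pd_det (hJ : IsJTensorOn D g J α) (hg : IsMetricOn D g) (hq : q ∈ D)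
    (hdet : (J q).det ≠ 0) (l : Fin n) :
    pd l (fun x => (J x).det) q = 2 * (J q).det * (α q ⬝ᵥ ((J q)⁻¹ *ᵥ Pi.single l 1)) := by
  have hJJ : (J q)⁻¹ * J q = 1 := Matrix.nonsing_inv_mul _ hdet.isUnit
  have h1 : (((J q)⁻¹ *ᵥ ((g q)⁻¹ *ᵥ α q)) ⬝ᵥ (g q *ᵥ Pi.single l 1))
      = α q ⬝ᵥ ((J q)⁻¹ *ᵥ Pi.single l 1) := by
    rw [Matrix.mulVec_mulVec, mulVec_dotProduct, hJ.inv_mul_inv_symm hg hq,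
      Matrix.mulVec_mulVec, Matrix.mul_assoc, hg.inv_mul hq, Matrix.mul_one]
  have h2 : ((J q)⁻¹ * (J q * connectionMatrix g q l)).trace
      = ((J q)⁻¹ * (connectionMatrix g q l * J q)).trace := by
    rw [← Matrix.mul_assoc, hJJ, Matrix.one_mul, ← Matrix.mul_assoc, Matrix.trace_mul_comm,
      ← Matrix.mul_assoc, Matrix.mul_nonsing_inv _ hdet.isUnit, Matrix.one_mul]
  rw [(differentiableAt_and_pd_det (hJ.differentiableAt hg hq)).2 l, adjugate_eq_det_smul_inv hdet,
    hJ.matDeriv_eq hq l, Matrix.smul_mul, Matrix.trace_smul, Matrix.mul_add, Matrix.mul_add,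
    Matrix.mul_sub, Matrix.mul_vecMulVec, Matrix.mul_vecMulVec, Matrix.trace_add, Matrix.trace_add,
    Matrix.trace_sub, Matrix.trace_vecMulVec, Matrix.trace_vecMulVec, h1, h2,
    dotProduct_comm _ (α q), smul_eq_mul]
  ring

lemma matDeriv_adjugate_mul_inv (hJ : IsJTensorOn D g J α) (hg : IsMetricOn D g) (hq : q ∈ D)
    (hdet : (J q).det ≠ 0) (l : Fin n) :
    matDeriv l (fun x => (J x).adjugate * (g x)⁻¹) q
      = (J q).det • ((2 * (α q ⬝ᵥ ((J q)⁻¹ *ᵥ Pi.single l 1))) • ((J q)⁻¹ * (g q)⁻¹)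
        - (connectionMatrix g q l * ((J q)⁻¹ * (g q)⁻¹)
          + (J q)⁻¹ * (g q)⁻¹ * (connectionMatrix g q l)ᵀ
          + Matrix.vecMulVec ((J q)⁻¹ *ᵥ Pi.single l 1) (α q) * ((J q)⁻¹ * (g q)⁻¹)
          + Matrix.vecMulVec ((J q)⁻¹ *ᵥ ((g q)⁻¹ *ᵥ α q)) (g q *ᵥ Pi.single l 1)
            * ((J q)⁻¹ * (g q)⁻¹))) := by
  have hdJ := hJ.differentiableAt hg hq
  have h1 : (J q)⁻¹ * matDeriv l J q
      = connectionMatrix g q l - (J q)⁻¹ * connectionMatrix g q l * J q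
        + Matrix.vecMulVec ((J q)⁻¹ *ᵥ Pi.single l 1) (α q)
        + Matrix.vecMulVec ((J q)⁻¹ *ᵥ ((g q)⁻¹ *ᵥ α q)) (g q *ᵥ Pi.single l 1) := by
    rw [hJ.matDeriv_eq hq l, Matrix.mul_add, Matrix.mul_add, Matrix.mul_sub, Matrix.mul_vecMulVec,
      Matrix.mul_vecMulVec, ← Matrix.mul_assoc, Matrix.nonsing_inv_mul _ hdet.isUnit,
      Matrix.one_mul, Matrix.mul_assoc]
  rw [matDeriv_mul (differentiableAt_adjugate hdJ)
      (differentiableAt_inv (hg.differentiableAt hq) (hg.det_ne_zero q hq)),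
    matDeriv_adjugate hdJ hdet, hg.matDeriv_inv_eq hq, hJ.pd_det hg hq hdet,
    adjugate_eq_det_smul_inv hdet, Matrix.smul_mul, Matrix.smul_mul, h1]
  have h2 : (J q)⁻¹ * connectionMatrix g q l * J q * (J q)⁻¹
      = (J q)⁻¹ * connectionMatrix g q l := by
    rw [Matrix.mul_assoc, Matrix.mul_nonsing_inv _ hdet.isUnit, Matrix.mul_one]
  simp only [Matrix.add_mul, Matrix.sub_mul, h2, Matrix.smul_mul, Matrix.mul_neg, Matrix.mul_add,
    ← Matrix.mul_assoc, smul_add, smul_sub, smul_smul]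
  rw [mul_left_comm, mul_assoc]
  abel

/-- The derivative of the kinetic energy `pᵀ (cof J) G p`, in terms of `w = J⁻¹ G p`. -/
lemma dotProduct_matDeriv_mulVec (hJ : IsJTensorOn D g J α) (hg : IsMetricOn D g) (hq : q ∈ D)
    (hdet : (J q).det ≠ 0) (l : Fin n) {w : Fin n → ℝ} (hw : w = (J q)⁻¹ *ᵥ ((g q)⁻¹ *ᵥ p)) :
    p ⬝ᵥ (matDeriv l (fun x => (J x).adjugate * (g x)⁻¹) q *ᵥ p)
      = 2 * (J q).det * ((α q ⬝ᵥ ((J q)⁻¹ *ᵥ Pi.single l 1)) * (p ⬝ᵥ w)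
        - p ⬝ᵥ (connectionMatrix g q l *ᵥ w) - (α q ⬝ᵥ w) * (g q *ᵥ w) l) := by
  have hS := hJ.inv_mul_inv_symm hg hq
  have hw' : ((J q)⁻¹ * (g q)⁻¹) *ᵥ p = w := by rw [hw, Matrix.mulVec_mulVec]
  have hdot : ∀ x, p ⬝ᵥ (((J q)⁻¹ * (g q)⁻¹) *ᵥ x) = w ⬝ᵥ x := fun x => by
    rw [← hw', mulVec_dotProduct, hS]
  have hgl : (g q *ᵥ Pi.single l 1) ⬝ᵥ w = (g q *ᵥ w) l := by
    rw [mulVec_dotProduct, hg.symm q hq, single_one_dotProduct]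
  have h1 : p ⬝ᵥ ((J q)⁻¹ *ᵥ Pi.single l 1) = (g q *ᵥ w) l := by
    rw [← hgl, dotProduct_comm _ w, ← hdot, Matrix.mulVec_mulVec, Matrix.mul_assoc, hg.inv_mul hq,
      Matrix.mul_one]
  have h2 : p ⬝ᵥ ((J q)⁻¹ *ᵥ ((g q)⁻¹ *ᵥ α q)) = α q ⬝ᵥ w := by
    rw [Matrix.mulVec_mulVec, hdot, dotProduct_comm]
  have h3 : w ⬝ᵥ ((connectionMatrix g q l)ᵀ *ᵥ p) = p ⬝ᵥ (connectionMatrix g q l *ᵥ w) := by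
    rw [← mulVec_dotProduct, dotProduct_comm]
  rw [hJ.matDeriv_adjugate_mul_inv hg hq hdet]
  simp only [Matrix.smul_mulVec, Matrix.sub_mulVec, Matrix.add_mulVec, dotProduct_smul,
    dotProduct_sub, dotProduct_add, ← Matrix.mulVec_mulVec p, ← hw, smul_eq_mul]
  rw [dotProduct_vecMulVec_mulVec, dotProduct_vecMulVec_mulVec, hdot, h1, h2, h3, hgl]
  ring

/-- The magnetic term `Ω w`: it depends on the derivatives of `J` only through the connection and
the `1`-form `α`. -/
lemma Omega_mulVec (hJ : IsJTensorOn D g J α) (hg : IsMetricOn D g) {z : Fin n ⊕ Fin n → ℝ}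
    (hz : pos z ∈ D) (w : Fin n → ℝ) (i : Fin n) :
    (Omega J z *ᵥ w) i = mom z ⬝ᵥ (connectionMatrix g (pos z) i *ᵥ (J (pos z) *ᵥ w))
      - ∑ l, J (pos z) l i * (mom z ⬝ᵥ (connectionMatrix g (pos z) l *ᵥ w))
      + (mom z ⬝ᵥ w) * α (pos z) i - mom z i * (α (pos z) ⬝ᵥ w) := by
  set q := pos z
  set C := connectionMatrix g q with hC
  have hsymm : ∀ a b c, C b a c = C c a b := hg.connectionMatrix_symm hz
  have h1 : ∀ k, ∑ j, matDeriv j J q k i * w j = (J q *ᵥ (C i *ᵥ w)) k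
      - ∑ l, J q l i * (C l *ᵥ w) k + w k * α q i + ((g q)⁻¹ *ᵥ α q) k * (g q *ᵥ w) i := fun k => by
    have h : ∀ j, matDeriv j J q k i = ∑ m, J q k m * C i m j - ∑ m, C m k j * J q m i
        + (Pi.single j 1 : Fin n → ℝ) k * α q i + ((g q)⁻¹ *ᵥ α q) k * g q i j := fun j => by
      rw [hJ.matDeriv_eq hz j]
      simp [Matrix.vecMulVec_apply, Matrix.mul_apply, ← hC, hsymm _ j _]
    simp only [h, add_mul, sub_mul, Finset.sum_add_distrib, Finset.sum_sub_distrib]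
    congr 2
    · congr 1
      · simp only [Matrix.mulVec, dotProduct, Finset.mul_sum, Finset.sum_mul]
        rw [Finset.sum_comm]
        exact Finset.sum_congr rfl fun _ _ => Finset.sum_congr rfl fun _ _ => by ring
      · simp only [Matrix.mulVec, dotProduct, Finset.mul_sum, Finset.sum_mul]
        rw [Finset.sum_comm]
        exact Finset.sum_congr rfl fun _ _ => Finset.sum_congr rfl fun _ _ => by ring
    · simp [Pi.single_apply, mul_comm]
    · simp only [Matrix.mulVec, dotProduct, Finset.mul_sum]
      exact Finset.sum_congr rfl fun _ _ => by ring
  have h2 : ∀ k, (matDeriv i J q *ᵥ w) k = (J q *ᵥ (C i *ᵥ w)) k - (C i *ᵥ (J q *ᵥ w)) k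
      + (Pi.single i 1 : Fin n → ℝ) k * (α q ⬝ᵥ w)
      + ((g q)⁻¹ *ᵥ α q) k * (g q *ᵥ w) i := fun k => by
    have hgi : (g q *ᵥ Pi.single i 1) ⬝ᵥ w = (g q *ᵥ w) i := by
      rw [mulVec_dotProduct, hg.symm q hz, single_one_dotProduct]
    rw [hJ.matDeriv_eq hz i, Matrix.add_mulVec, Matrix.add_mulVec, Matrix.sub_mulVec,
      Matrix.vecMulVec_mulVec, Matrix.vecMulVec_mulVec, hgi]
    simp [← hC]
    ring
  have h3 : (Omega J z *ᵥ w) i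
      = ∑ k, mom z k * (∑ j, matDeriv j J q k i * w j - (matDeriv i J q *ᵥ w) k) := by
    simp only [Matrix.mulVec, dotProduct, Omega, Matrix.of_apply, matDeriv_apply,
      ← Finset.sum_sub_distrib, Finset.mul_sum, Finset.sum_mul]
    rw [Finset.sum_comm]
    exact Finset.sum_congr rfl fun _ _ => Finset.sum_congr rfl fun _ _ => by ring
  have h4 : ∑ l, J q l i * (mom z ⬝ᵥ (C l *ᵥ w))
      = ∑ k, mom z k * ∑ l, J q l i * (C l *ᵥ w) k := by
    simp only [dotProduct, Finset.mul_sum]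
    rw [Finset.sum_comm]
    exact Finset.sum_congr rfl fun _ _ => Finset.sum_congr rfl fun _ _ => by ring
  have h5 : mom z i * (α q ⬝ᵥ w)
      = ∑ k, mom z k * ((Pi.single i 1 : Fin n → ℝ) k * (α q ⬝ᵥ w)) := by
    simp [Pi.single_apply]
  rw [h3, h4, h5, dotProduct, dotProduct, Finset.sum_mul, ← Finset.sum_sub_distrib,
    ← Finset.sum_add_distrib, ← Finset.sum_sub_distrib]
  refine Finset.sum_congr rfl fun k _ => ?_
  rw [h1, h2]
  ring

end IsJTensorOn

/-- The differential of a natural Hamiltonian `½ pᵀ A(q) p + V(q)` with symmetric `A`. -/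
lemma differential_natural_hamiltonian {A : (Fin n → ℝ) → Matrix (Fin n) (Fin n) ℝ}
    {V : (Fin n → ℝ) → ℝ} {z : Fin n ⊕ Fin n → ℝ}
    (hA : ∀ i j, DifferentiableAt ℝ (fun x => A x i j) (pos z))
    (hV : DifferentiableAt ℝ V (pos z)) (hsymm : (A (pos z))ᵀ = A (pos z)) :
    differential (fun y => (1 / 2) * (mom y ⬝ᵥ (A (pos y) *ᵥ mom y)) + V (pos y)) z
      = Sum.elim
        (fun l => (1 / 2) * (mom z ⬝ᵥ (matDeriv l A (pos z) *ᵥ mom z)) + pd l V (pos z))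
        (A (pos z) *ᵥ mom z) := by
  have hp := fun k => differentiable_mom (n := n) k z
  have hin : ∀ i, DifferentiableAt ℝ (fun y => ∑ j, A (pos y) i j * mom y j) z := fun i =>
    DifferentiableAt.fun_sum fun j _ => (differentiableAt_comp_pos (hA i j)).fun_mul (hp j)
  have hquad : DifferentiableAt ℝ (fun y => mom y ⬝ᵥ (A (pos y) *ᵥ mom y)) z :=
    DifferentiableAt.fun_sum fun i _ => (hp i).fun_mul (hin i)
  have key : ∀ a, pd a (fun y => mom y ⬝ᵥ (A (pos y) *ᵥ mom y)) z
      = ∑ i, (pd a (fun y => mom y i) z * (A (pos z) *ᵥ mom z) i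
        + mom z i * pd a (fun y => ∑ j, A (pos y) i j * mom y j) z) := fun a => by
    simp only [dotProduct, Matrix.mulVec]
    rw [pd_sum fun i _ => (hp i).fun_mul (hin i)]
    exact Finset.sum_congr rfl fun i _ => pd_mul (hp i) (hin i)
  ext a
  rw [differential, pd_add (hquad.const_mul _) (differentiableAt_comp_pos hV),
    pd_const_mul hquad, key]
  rcases a with l | l
  · simp only [pd_inl_mom, pd_inl_linear_mom (hA _), pd_inl_comp_pos hV, zero_mul, zero_add,
      Sum.elim_inl]
    rfl
  · simp only [pd_inr_mom, pd_inr_linear_mom (hA _), pd_inr_comp_pos hV, Sum.elim_inr,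
      Finset.sum_add_distrib, add_zero]
    have h1 : ∑ i, mom z i * A (pos z) i l = (A (pos z) *ᵥ mom z) l := by
      conv_rhs => rw [← hsymm]
      exact Finset.sum_congr rfl fun i _ => mul_comm _ _
    rw [h1]
    simp
    ring

lemma IsJTensorOn.differential_cofactorHamiltonian (hJ : IsJTensorOn D g J α)
    (hg : IsMetricOn D g) {V : (Fin n → ℝ) → ℝ} {z : Fin n ⊕ Fin n → ℝ} (hz : pos z ∈ D)
    (hdet : (J (pos z)).det ≠ 0) (hV : DifferentiableAt ℝ V (pos z)) :
    differential (cofactorHamiltonian g J V) z = Sum.elim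
      (fun l => (1 / 2) * (mom z ⬝ᵥ
        (matDeriv l (fun x => (J x).adjugate * (g x)⁻¹) (pos z) *ᵥ mom z)) + pd l V (pos z))
      (((J (pos z)).adjugate * (g (pos z))⁻¹) *ᵥ mom z) := by
  have hAd : ∀ i j, DifferentiableAt ℝ (fun x => ((J x).adjugate * (g x)⁻¹) i j) (pos z) :=
    fun i j => by
      simp only [Matrix.mul_apply]
      exact DifferentiableAt.fun_sum fun k _ =>
        (differentiableAt_adjugate (hJ.differentiableAt hg hz) i k).fun_mul
          (differentiableAt_inv (hg.differentiableAt hz) (hg.det_ne_zero _ hz) k j)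
  have hAs : ((J (pos z)).adjugate * (g (pos z))⁻¹)ᵀ = (J (pos z)).adjugate * (g (pos z))⁻¹ := by
    rw [adjugate_eq_det_smul_inv hdet, Matrix.smul_mul, Matrix.transpose_smul,
      hJ.inv_mul_inv_symm hg hz]
  exact differential_natural_hamiltonian (A := fun x => (J x).adjugate * (g x)⁻¹) hAd hV hAs

/-- The vector field `(1/σ) Π_nc(J) dH` of a cofactor Hamiltonian is the vector field of the Newton
system with force `-(cof J)⁻¹ ∇V`. In particular it depends on `J` through the force alone. -/
theorem quasiHamiltonianField_eq_newtonField (hg : IsMetricOn D g) (hJ : IsJTensorOn D g J α)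
    {V : (Fin n → ℝ) → ℝ} {F : (Fin n → ℝ) → Fin n → ℝ} {z : Fin n ⊕ Fin n → ℝ} (hz : pos z ∈ D)
    (hdet : (J (pos z)).det ≠ 0) (hV : DifferentiableAt ℝ V (pos z))
    (hF : F (pos z) = -((J (pos z)).adjugate⁻¹ *ᵥ ((g (pos z))⁻¹ *ᵥ differential V (pos z)))) :
    quasiHamiltonianField J (cofactorHamiltonian g J V) z = newtonField g F z := by
  set q := pos z with hq
  set p := mom z with hp
  set w := (J q)⁻¹ *ᵥ ((g q)⁻¹ *ᵥ p) with hw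
  have hJw : J q *ᵥ w = (g q)⁻¹ *ᵥ p := by
    rw [hw, Matrix.mulVec_mulVec, Matrix.mul_nonsing_inv _ hdet.isUnit, Matrix.one_mulVec]
  have hAp : ((J q).adjugate * (g q)⁻¹) *ᵥ p = (J q).det • w := by
    rw [adjugate_eq_det_smul_inv hdet, Matrix.smul_mul, Matrix.smul_mulVec, hw,
      Matrix.mulVec_mulVec]
  have hH : differential (cofactorHamiltonian g J V) z = Sum.elim
      (fun l => (1 / 2) * (p ⬝ᵥ (matDeriv l (fun x => (J x).adjugate * (g x)⁻¹) q *ᵥ p)) + pd l V q)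
      ((J q).det • w) := by
    rw [← hAp]
    exact hJ.differential_cofactorHamiltonian hg hz hdet hV
  have hgF : g q *ᵥ F q = -((J q).det⁻¹ • ((J q)ᵀ *ᵥ differential V q)) := by
    rw [hF, adjugate_inv_eq hdet, Matrix.mulVec_neg, Matrix.smul_mulVec, Matrix.mulVec_smul,
      Matrix.mulVec_mulVec, Matrix.mulVec_mulVec, hJ.mul_eq_transpose_mul hg hz, Matrix.mul_assoc,
      hg.mul_inv hz, Matrix.mul_one]
  -- contracting the derivative of the kinetic energy with `Jᵀ` turns `J⁻ᵀ α` into `α` and `g w`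
  -- into `p`, which are the quantities that occur in `Ω w`
  have hJα : ∀ i, ∑ l, J q l i * (α q ⬝ᵥ ((J q)⁻¹ *ᵥ Pi.single l 1)) = α q i := fun i => by
    have h : ∀ l, α q ⬝ᵥ ((J q)⁻¹ *ᵥ Pi.single l 1) = (α q ᵥ* (J q)⁻¹) l := fun l => by
      rw [Matrix.dotProduct_mulVec, dotProduct_single_one]
    calc ∑ l, J q l i * (α q ⬝ᵥ ((J q)⁻¹ *ᵥ Pi.single l 1))
        = ((α q ᵥ* (J q)⁻¹) ᵥ* J q) i := by
          simp only [h]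
          exact Finset.sum_congr rfl fun _ _ => mul_comm _ _
      _ = α q i := by
          rw [Matrix.vecMul_vecMul, Matrix.nonsing_inv_mul _ hdet.isUnit, Matrix.vecMul_one]
  have hJg : ∀ i, ∑ l, J q l i * (g q *ᵥ w) l = p i := fun i => by
    change ((J q)ᵀ *ᵥ (g q *ᵥ w)) i = p i
    rw [Matrix.mulVec_mulVec, ← hJ.mul_eq_transpose_mul hg hz, ← Matrix.mulVec_mulVec, hJw,
      Matrix.mulVec_mulVec, hg.mul_inv hz, Matrix.one_mulVec]
  rw [quasiHamiltonianField, hH, PiNC, Matrix.fromBlocks_mulVec, ← hq]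
  ext (i | i)
  · simp only [newtonField, Pi.smul_apply, Sum.elim_inl, Sum.elim_comp_inl, Sum.elim_comp_inr,
      Pi.add_apply, Matrix.zero_mulVec, Pi.zero_apply, Matrix.mulVec_smul, hJw, smul_eq_mul,
      ← hq, ← hp]
    field_simp
    ring
  · have h1 : ((J q)ᵀ *ᵥ fun l =>
        (1 / 2) * (p ⬝ᵥ (matDeriv l (fun x => (J x).adjugate * (g x)⁻¹) q *ᵥ p)) + pd l V q) i
        = (J q).det * (α q i * (p ⬝ᵥ w)
          - ∑ l, J q l i * (p ⬝ᵥ (connectionMatrix g q l *ᵥ w)) - (α q ⬝ᵥ w) * p i)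
          + ((J q)ᵀ *ᵥ differential V q) i := by
      rw [← hJα i, ← hJg i]
      have hsum : ∀ f, ((J q)ᵀ *ᵥ f) i = ∑ l, J q l i * f l := fun f => rfl
      rw [hsum, hsum]
      simp only [hJ.dotProduct_matDeriv_mulVec hg hz hdet _ hw, Finset.sum_mul, Finset.mul_sum,
        ← Finset.sum_sub_distrib, ← Finset.sum_add_distrib, differential]
      exact Finset.sum_congr rfl fun l _ => by ring
    simp only [newtonField, Pi.smul_apply, Sum.elim_inr, Sum.elim_comp_inl, Sum.elim_comp_inr,
      Pi.add_apply, Matrix.neg_mulVec, Pi.neg_apply, Matrix.mulVec_smul, smul_eq_mul,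
      ← hq, ← hp, h1, hgF, hJ.Omega_mulVec hg hz, hJw]
    field_simp
    ring

end HamiltonianField

/-! ### Newton's equations and the first-order system -/

section Curves

variable {n : ℕ} {D : Set (Fin n → ℝ)} {g : (Fin n → ℝ) → Matrix (Fin n) (Fin n) ℝ}

lemma hasDerivAt_mulVec_curve {M : (Fin n → ℝ) → Matrix (Fin n) (Fin n) ℝ} {q u : ℝ → Fin n → ℝ}
    {v a : Fin n → ℝ} {t : ℝ} (hM : ∀ i j, DifferentiableAt ℝ (fun x => M x i j) (q t))
    (hq : HasDerivAt q v t) (hu : HasDerivAt u a t) :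
    HasDerivAt (fun τ => M (q τ) *ᵥ u τ)
      (∑ h, v h • (matDeriv h M (q t) *ᵥ u t) + M (q t) *ᵥ a) t := by
  refine hasDerivAt_pi.2 fun i => ?_
  have h := HasDerivAt.fun_sum (u := Finset.univ) fun j _ =>
    (hasDerivAt_comp_curve (hM i j) hq).fun_mul (hasDerivAt_pi.1 hu j)
  refine h.congr_deriv ?_
  rw [Finset.sum_add_distrib, Pi.add_apply, Finset.sum_apply]
  congr 1
  simp only [Pi.smul_apply, smul_eq_mul, Matrix.mulVec, dotProduct, matDeriv_apply,
    Finset.mul_sum, Finset.sum_mul]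
  rw [Finset.sum_comm]
  exact Finset.sum_congr rfl fun _ _ => Finset.sum_congr rfl fun _ _ => by ring

/-- Along a curve with velocity `v` and acceleration `a`, the momentum `g v` has derivative
`g ∇ᵥv + (Γᵏᵢₗ vˡ gₖₘ vᵐ)ᵢ`. -/
lemma IsMetricOn.hasDerivAt_momentum (hg : IsMetricOn D g) {q u : ℝ → Fin n → ℝ}
    {a : Fin n → ℝ} {t : ℝ} (hqD : q t ∈ D) (hq : HasDerivAt q (u t) t) (hu : HasDerivAt u a t) :
    HasDerivAt (fun τ => g (q τ) *ᵥ u τ)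
      (g (q t) *ᵥ (fun i => a i + ∑ j, ∑ k, christoffel g (q t) i j k * u t j * u t k)
        + fun i => (g (q t) *ᵥ u t) ⬝ᵥ (connectionMatrix g (q t) i *ᵥ u t)) t := by
  refine (hasDerivAt_mulVec_curve (hg.differentiableAt hqD) hq hu).congr_deriv ?_
  have hacc : (fun i => a i + ∑ j, ∑ k, christoffel g (q t) i j k * u t j * u t k)
      = a + ∑ h, u t h • (connectionMatrix g (q t) h *ᵥ u t) := by
    ext i
    simp only [Pi.add_apply, Finset.sum_apply, Pi.smul_apply, smul_eq_mul, Matrix.mulVec,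
      dotProduct, Finset.mul_sum, connectionMatrix, Matrix.of_apply]
    congr 1
    exact Finset.sum_congr rfl fun _ _ => Finset.sum_congr rfl fun _ _ => by ring
  have hlow : ∑ h, u t h • (((connectionMatrix g (q t) h)ᵀ * g (q t)) *ᵥ u t)
      = fun i => (g (q t) *ᵥ u t) ⬝ᵥ (connectionMatrix g (q t) i *ᵥ u t) := by
    ext i
    simp only [← Matrix.mulVec_mulVec, Finset.sum_apply, Pi.smul_apply, smul_eq_mul]
    generalize g (q t) *ᵥ u t = p
    simp only [Matrix.mulVec, dotProduct, Finset.mul_sum, Matrix.transpose_apply,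
      hg.connectionMatrix_symm hqD _ _ i]
    rw [Finset.sum_comm]
    exact Finset.sum_congr rfl fun _ _ => Finset.sum_congr rfl fun _ _ => by ring
  simp only [hg.matDeriv_eq hqD, Matrix.add_mulVec, smul_add, Finset.sum_add_distrib, hlow, hacc,
    Matrix.mulVec_add, Matrix.mulVec_sum, Matrix.mulVec_smul,
    ← Matrix.mulVec_mulVec (u t) (g (q t))]
  abel

/-- With the momenta `p = g q̇`, the Newton system is the flow of `newtonField`. -/
theorem isNewtonSolutionOn_iff (hg : IsMetricOn D g) (F : (Fin n → ℝ) → Fin n → ℝ) {s : Set ℝ}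
    (hs : IsOpen s) {q p : ℝ → Fin n → ℝ} (hqD : ∀ t ∈ s, q t ∈ D) :
    (IsNewtonSolutionOn g F q s ∧ ∀ t ∈ s, p t = g (q t) *ᵥ deriv q t) ↔
      ∀ t ∈ s, HasDerivAt (fun τ => Sum.elim (q τ) (p τ))
        (newtonField g F (Sum.elim (q t) (p t))) t := by
  constructor
  · rintro ⟨hN, hp⟩ t ht
    obtain ⟨hq, hu, heq⟩ := hN t ht
    have hpe : p =ᶠ[nhds t] fun τ => g (q τ) *ᵥ deriv q τ := by
      filter_upwards [hs.mem_nhds ht] with τ hτ using hp τ hτ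
    have hmom := (hg.hasDerivAt_momentum (hqD t ht) hq.hasDerivAt
      hu.hasDerivAt).congr_of_eventuallyEq hpe
    have hv : (g (q t))⁻¹ *ᵥ p t = deriv q t := by
      rw [hp t ht, Matrix.mulVec_mulVec, hg.inv_mul (hqD t ht), Matrix.one_mulVec]
    have hF : (fun i => deriv (deriv q) t i
        + ∑ j, ∑ k, christoffel g (q t) i j k * deriv q t j * deriv q t k) = F (q t) := funext heq
    rw [hF, ← hp t ht, ← hv] at hmom
    refine hasDerivAt_pi.2 ?_
    rintro (i | i)
    · have h := hasDerivAt_pi.1 hq.hasDerivAt i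
      rw [← hv] at h
      exact h
    · have h := hasDerivAt_pi.1 hmom i
      rw [Pi.add_apply, add_comm] at h
      exact h
  · intro h
    have hq : ∀ t ∈ s, HasDerivAt q ((g (q t))⁻¹ *ᵥ p t) t := fun t ht =>
      hasDerivAt_pi.2 fun i => hasDerivAt_pi.1 (h t ht) (Sum.inl i)
    have hpd : ∀ t ∈ s, HasDerivAt p (fun i => p t ⬝ᵥ (connectionMatrix g (q t) i *ᵥ
        ((g (q t))⁻¹ *ᵥ p t)) + (g (q t) *ᵥ F (q t)) i) t := fun t ht =>
      hasDerivAt_pi.2 fun i => hasDerivAt_pi.1 (h t ht) (Sum.inr i)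
    have hp : ∀ t ∈ s, p t = g (q t) *ᵥ deriv q t := fun t ht => by
      rw [(hq t ht).deriv, Matrix.mulVec_mulVec, hg.mul_inv (hqD t ht), Matrix.one_mulVec]
    refine ⟨fun t ht => ?_, hp⟩
    have hue : deriv q =ᶠ[nhds t] fun τ => (g (q τ))⁻¹ *ᵥ p τ := by
      filter_upwards [hs.mem_nhds ht] with τ hτ using (hq τ hτ).deriv
    have hu : DifferentiableAt ℝ (deriv q) t :=
      ((hasDerivAt_mulVec_curve (M := fun x => (g x)⁻¹)
        (differentiableAt_inv (hg.differentiableAt (hqD t ht)) (hg.det_ne_zero _ (hqD t ht)))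
        (hq t ht) (hpd t ht)).congr_of_eventuallyEq hue).differentiableAt
    have hqt := (hq t ht).differentiableAt
    refine ⟨hqt, hu, fun i => ?_⟩
    have hpe : p =ᶠ[nhds t] fun τ => g (q τ) *ᵥ deriv q τ := by
      filter_upwards [hs.mem_nhds ht] with τ hτ using hp τ hτ
    have hmom := (hg.hasDerivAt_momentum (hqD t ht) hqt.hasDerivAt
      hu.hasDerivAt).congr_of_eventuallyEq hpe
    have huniq := hmom.unique (hpd t ht)
    rw [← hp t ht, ← (hq t ht).deriv] at huniq
    have hlow : g (q t) *ᵥ (fun i => deriv (deriv q) t i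
        + ∑ j, ∑ k, christoffel g (q t) i j k * deriv q t j * deriv q t k)
        = g (q t) *ᵥ F (q t) := by
      ext i
      have h := congrFun huniq i
      rw [Pi.add_apply] at h
      linarith
    have hup := congrArg ((g (q t))⁻¹ *ᵥ ·) hlow
    simp only [Matrix.mulVec_mulVec, hg.inv_mul (hqD t ht), Matrix.one_mulVec] at hup
    exact congrFun hup i

end Curves

/-! ### Tensor fields in a chart -/

section Charts

variable {n : ℕ} {Q : Type*} [TopologicalSpace Q] [ChartedSpace (Fin n → ℝ) Q]
  {e : OpenPartialHomeomorph Q (Fin n → ℝ)} {u : Fin n → ℝ}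

lemma mdifferentiable_chart (he : e ∈ charts n Q) :
    e.MDifferentiable 𝓘(ℝ, Fin n → ℝ) 𝓘(ℝ, Fin n → ℝ) :=
  ⟨(contMDiffOn_of_mem_maximalAtlas he).mdifferentiableOn (by simp),
    (contMDiffOn_symm_of_mem_maximalAtlas he).mdifferentiableOn (by simp)⟩

lemma sum_smul_frame (e : OpenPartialHomeomorph Q (Fin n → ℝ)) (u v : Fin n → ℝ) :
    ∑ i, v i • frame e u i = mfderiv 𝓘(ℝ, Fin n → ℝ) 𝓘(ℝ, Fin n → ℝ) e.symm u v := by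
  have h : v = ∑ i, v i • (Pi.single i 1 : Fin n → ℝ) := by
    ext j
    simp [Finset.sum_apply, Pi.single_apply]
  have h2 := map_sum (mfderiv 𝓘(ℝ, Fin n → ℝ) 𝓘(ℝ, Fin n → ℝ) e.symm u)
    (fun i => (v i • (Pi.single i 1 : Fin n → ℝ) : Fin n → ℝ)) Finset.univ
  conv_rhs => rw [h]
  refine Eq.trans (Finset.sum_congr rfl fun i _ => ?_) h2.symm
  exact (map_smul (mfderiv 𝓘(ℝ, Fin n → ℝ) 𝓘(ℝ, Fin n → ℝ) e.symm u) (v i) _).symm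

lemma sum_smul_frame_injective (he : e ∈ charts n Q) (hu : u ∈ e.target) {v : Fin n → ℝ}
    (hv : ∑ i, v i • frame e u i = 0) : v = 0 := by
  rw [sum_smul_frame] at hv
  exact (mdifferentiable_chart he).symm.mfderiv_injective hu (hv.trans (map_zero _).symm)

lemma exists_sum_smul_frame_eq (he : e ∈ charts n Q) (hu : u ∈ e.target)
    (X : TangentSpace 𝓘(ℝ, Fin n → ℝ) (e.symm u)) :
    ∃ v : Fin n → ℝ, ∑ i, v i • frame e u i = X := by
  obtain ⟨v, hv⟩ := (mdifferentiable_chart he).symm.mfderiv_surjective hu X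
  exact ⟨v, (sum_smul_frame e u v).trans hv⟩

lemma bilinCoord_mulVec (g : BilinField n Q) (v : Fin n → ℝ) (i : Fin n) :
    (bilinCoord g e u *ᵥ v) i = g (e.symm u) (frame e u i) (∑ j, v j • frame e u j) := by
  simp [Matrix.mulVec, dotProduct, bilinCoord, mul_comm]

lemma map_sum_smul_apply {E : Type*} [AddCommGroup E] [Module ℝ E] (L : E →ₗ[ℝ] Fin n → ℝ)
    (f : Fin n → E) (v : Fin n → ℝ) (i : Fin n) :
    L (∑ j, v j • f j) i = ∑ j, L (f j) i * v j := by
  simp [mul_comm]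

lemma endoCoord_mulVec (J : EndoField n Q) (v : Fin n → ℝ) :
    endoCoord J e u *ᵥ v = tangentCoord e u (J (e.symm u) (∑ j, v j • frame e u j)) := by
  ext i
  exact (map_sum_smul_apply (((mfderiv 𝓘(ℝ, Fin n → ℝ) 𝓘(ℝ, Fin n → ℝ) e (e.symm u)).comp
    (J (e.symm u))).toLinearMap) (frame e u) v i).symm

lemma IsPseudoMetric.isMetricOn {g : BilinField n Q} (hg : IsPseudoMetric g)
    (he : e ∈ charts n Q) : IsMetricOn e.target (bilinCoord g e) where
  isOpen := e.open_target
  smooth := hg.smooth e he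
  symm u _ := by
    ext i j
    exact hg.symm _ _ _
  det_ne_zero u hu h0 := by
    obtain ⟨v, hv0, hv⟩ := Matrix.exists_mulVec_eq_zero_iff.2 h0
    refine hv0 (sum_smul_frame_injective he hu (hg.nondegenerate _ _ fun Y => ?_))
    obtain ⟨y, rfl⟩ := exists_sum_smul_frame_eq he hu Y
    rw [map_sum]
    refine Finset.sum_eq_zero fun i _ => ?_
    rw [map_smul, hg.symm, ← bilinCoord_mulVec, hv]
    simp

lemma det_endoCoord_ne_zero {J : EndoField n Q} (hJ : ∀ x, Function.Bijective (J x))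
    (he : e ∈ charts n Q) (hu : u ∈ e.target) : (endoCoord J e u).det ≠ 0 := by
  intro h0
  obtain ⟨v, hv0, hv⟩ := Matrix.exists_mulVec_eq_zero_iff.2 h0
  refine hv0 (sum_smul_frame_injective he hu ((hJ _).1 ?_))
  rw [endoCoord_mulVec] at hv
  exact (mdifferentiable_chart he).mfderiv_injective (e.map_target hu)
    ((hv.trans (map_zero _).symm).trans (congrArg _ (map_zero _).symm))

lemma IsJTensor.exists_isJTensorOn {g : BilinField n Q} {J : EndoField n Q} (hJ : IsJTensor g J)
    (he : e ∈ charts n Q) : ∃ α, IsJTensorOn e.target (bilinCoord g e) (endoCoord J e) α := by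
  obtain ⟨α, hα⟩ := hJ.characteristic
  exact ⟨covectorCoord α e, hJ.smooth e he, hJ.symm e he, hα e he⟩

lemma differentiableAt_funCoord {V : Q → ℝ}
    (hV : ContMDiff 𝓘(ℝ, Fin n → ℝ) 𝓘(ℝ, ℝ) ∞ V) (he : e ∈ charts n Q) (hu : u ∈ e.target) :
    DifferentiableAt ℝ (funCoord V e) u :=
  ((hV.comp_contMDiffOn (contMDiffOn_symm_of_mem_maximalAtlas he)).contDiffOn.contDiffAt
    (e.open_target.mem_nhds hu)).differentiableAt (by simp)

/-- In a chart, the quasi-Hamiltonian field of a nonsingular `J`-tensor and the potential `V` is the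
vector field of the Newton system with force `-(cof J)⁻¹ ∇V`. -/
lemma quasiHamiltonianField_chart_eq {g : BilinField n Q} {J : EndoField n Q} {V : Q → ℝ}
    {F : VecField n Q} (hg : IsPseudoMetric g) (hJ : IsJTensor g J)
    (hdet : ∀ x, Function.Bijective (J x)) (hV : ContMDiff 𝓘(ℝ, Fin n → ℝ) 𝓘(ℝ, ℝ) ∞ V)
    (hF : IsCofactorForce g J V F) (he : e ∈ charts n Q) {z : Fin n ⊕ Fin n → ℝ}
    (hz : pos z ∈ e.target) :
    quasiHamiltonianField (endoCoord J e)
        (cofactorHamiltonian (bilinCoord g e) (endoCoord J e) (funCoord V e)) z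
      = newtonField (bilinCoord g e) (vecCoord F e) z := by
  obtain ⟨α, hα⟩ := hJ.exists_isJTensorOn he
  exact quasiHamiltonianField_eq_newtonField (hg.isMetricOn he) hα hz
    (det_endoCoord_ne_zero hdet he hz) (differentiableAt_funCoord hV he hz) (hF e he _ hz)

end Charts

end BiCofactor

end

theorem mainTheorem4 {n : ℕ} {Q : Type*} [TopologicalSpace Q] [ChartedSpace (Fin n → ℝ) Q]
    [IsManifold 𝓘(ℝ, Fin n → ℝ) ∞ Q]
    (g : BiCofactor.BilinField n Q) (J₁ J₂ : BiCofactor.EndoField n Q)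
    (V W : Q → ℝ) (F : BiCofactor.VecField n Q)
    (hg : BiCofactor.IsPseudoMetric g)
    (hJ₁ : BiCofactor.IsJTensor g J₁) (hJ₂ : BiCofactor.IsJTensor g J₂)
    (hdet₁ : ∀ x, Function.Bijective (J₁ x)) (hdet₂ : ∀ x, Function.Bijective (J₂ x))
    (hV : ContMDiff 𝓘(ℝ, Fin n → ℝ) 𝓘(ℝ, ℝ) ∞ V) (hW : ContMDiff 𝓘(ℝ, Fin n → ℝ) 𝓘(ℝ, ℝ) ∞ W)
    (hFV : BiCofactor.IsCofactorForce g J₁ V F) (hFW : BiCofactor.IsCofactorForce g J₂ W F)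
    -- an arbitrary chart `(qⁱ)` of `Q`, with the induced coordinates `(qⁱ, pⱼ)` on `T*Q`
    (e : OpenPartialHomeomorph Q (Fin n → ℝ)) (he : e ∈ BiCofactor.charts n Q)
    (gc Jc₁ Jc₂ : (Fin n → ℝ) → Matrix (Fin n) (Fin n) ℝ)
    (hgc : gc = BiCofactor.bilinCoord g e)
    (hJc₁ : Jc₁ = BiCofactor.endoCoord J₁ e) (hJc₂ : Jc₂ = BiCofactor.endoCoord J₂ e)
    (HV HW : (Fin n ⊕ Fin n → ℝ) → ℝ)
    (hHV : HV = BiCofactor.cofactorHamiltonian gc Jc₁ (BiCofactor.funCoord V e))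
    (hHW : HW = BiCofactor.cofactorHamiltonian gc Jc₂ (BiCofactor.funCoord W e)) :
    -- the Newton system, with momenta `pᵢ = gᵢⱼ q̇ʲ`, is the system `d/dt (q, p) = (1/σ₁) Π₁ dH`,
    -- and it is the system `d/dt (q, p) = (1/σ₂) Π₂ dF`
    (∀ (s : Set ℝ) (_ : IsOpen s) (q p : ℝ → Fin n → ℝ) (_ : ∀ t ∈ s, q t ∈ e.target),
      ((BiCofactor.IsNewtonSolutionOn gc (BiCofactor.vecCoord F e) q s ∧
          ∀ t ∈ s, p t = gc (q t) *ᵥ deriv q t) ↔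
        ∀ t ∈ s, HasDerivAt (fun τ => Sum.elim (q τ) (p τ))
          (BiCofactor.quasiHamiltonianField Jc₁ HV (Sum.elim (q t) (p t))) t) ∧
      ((BiCofactor.IsNewtonSolutionOn gc (BiCofactor.vecCoord F e) q s ∧
          ∀ t ∈ s, p t = gc (q t) *ᵥ deriv q t) ↔
        ∀ t ∈ s, HasDerivAt (fun τ => Sum.elim (q τ) (p τ))
          (BiCofactor.quasiHamiltonianField Jc₂ HW (Sum.elim (q t) (p t))) t)) ∧
    -- the two vector fields on the phase space coincide
    (∀ z, BiCofactor.pos z ∈ e.target →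
      BiCofactor.quasiHamiltonianField Jc₁ HV z = BiCofactor.quasiHamiltonianField Jc₂ HW z) ∧
    -- the two operators are Poisson and compatible
    BiCofactor.AreCompatiblePoissonOn {z | BiCofactor.pos z ∈ e.target}
      (BiCofactor.PiNC Jc₁) (BiCofactor.PiNC Jc₂) := by
  subst hgc hJc₁ hJc₂ hHV hHW
  have hgD := hg.isMetricOn he
  have hfield₁ := fun z hz =>
    BiCofactor.quasiHamiltonianField_chart_eq hg hJ₁ hdet₁ hV hFV he (z := z) hz
  have hfield₂ := fun z hz =>
    BiCofactor.quasiHamiltonianField_chart_eq hg hJ₂ hdet₂ hW hFW he (z := z) hz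
  obtain ⟨α₁, hα₁⟩ := hJ₁.exists_isJTensorOn he
  obtain ⟨α₂, hα₂⟩ := hJ₂.exists_isJTensorOn he
  refine ⟨fun s hs q p hq => ?_, fun z hz => (hfield₁ z hz).trans (hfield₂ z hz).symm,
    BiCofactor.areCompatiblePoissonOn_PiNC hgD hα₁ hα₂⟩
  have hiff := BiCofactor.isNewtonSolutionOn_iff hgD (BiCofactor.vecCoord F e) hs (p := p) hq
  constructor
  · exact hiff.trans (forall₂_congr fun t ht => by rw [hfield₁ (Sum.elim (q t) (p t)) (hq t ht)])
  · exact hiff.trans (forall₂_congr fun t ht => by rw [hfield₂ (Sum.elim (q t) (p t)) (hq t ht)])
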